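/- Let $n\ge 0$ and let $\Omega_n=\mathbb{C}[x_1,\dots,x_n]\otimes\bigwedge\{\theta_1,\dots,\theta_n\}$, where the $x_i$ commute with everything and the $\theta_i$ anticommute with each other. For $f\in\Omega_n$ put $df=\sum_i(\partial f/\partial x_i)\,\theta_i$ (the $\theta_j$ being treated as constants in $\partial f/\partial x_i$), and for $f,g\in\Omega_n$ put $f\odot g=f(\partial_1,\dots,\partial_n,\partial^\theta_1,\dots,\partial^\theta_n)(g)$, where $\partial_i=\partial/\partial x_i$ and $\partial_i^\theta$ is the contraction operator: for distinct $j_1,\dots,j_r$, $\partial^\theta_i(\theta_{j_1}\cdots\theta_{j_r})=(-1)^{s-1}\theta_{j_1}\cdots\widehat{\theta_{j_s}}\cdots\theta_{j_r}$ if $j_s=i$, and $0$ if $i\notin\{j_1,\dots,j_r\}$. For a two-sided ideal $I\subseteq\Omega_n$ let $I^\perp=\{g\in\Omega_n: f\odot g=0\text{ for all }f\in I\}$. Let $\mathcal{A}=(H_i)_{i\in\mathcal I}$ be a finite multiarrangement of linear hyperplanes in $\mathbb{C}^n$ (repetitions allowed), where $H_i$ is the zero set of a homogeneous linear form $\alpha_i\in\mathbb{C}[x_1,\dots,x_n]$;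 degenerate hyperplanes (loops) $\alpha_i=0$, $H_i=\mathbb{C}^n$, are allowed too. For a line $L=\mathbb{C}\cdot(\ell_1,\dots,\ell_n)$ through the origin let $\lambda_L=\ell_1x_1+\cdots+\ell_nx_n$ and $\rho_{\mathcal{A}}(L)=\#\{i: L\not\subseteq H_i\}$, and let $$I_{\mathcal{A}}=\left(\lambda_L^{\rho_{\mathcal{A}}(L)+1},\ d\bigl(\lambda_L^{\rho_{\mathcal{A}}(L)+1}\bigr)\ :\ L\subseteq\mathbb{C}^n\text{ a line}\right)\subseteq\Omega_n .$$ Fix a total order on the index set $\mathcal I$, which gives a lexicographic order on its subsets. A basis of $\mathcal{A}$ is a subset $B\subseteq\mathcal I$ such that $(\alpha_i)_{i\in B}$ is a basis of the span of $(\alpha_i)_{i\in\mathcal I}$. An element $h\notin B$ is externally active with respect to $B$ if $B$ is the lexicographically largest basis contained in $B\cup\{h\}$, and externally passive otherwise; an element $h\in B$ is internally active if $B$ is the lexicographically smallest basis containing $B\setminus\{h\}$, and internally passive otherwise. Let $EP(B)$, $IA(B)$, $IP(B)$ be the sets of externally passive, internally active and internally passive elements with respect to $B$. Then the products $$\prod_{e\in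 E}\alpha_e\times\prod_{i\in I}d\alpha_i\times\prod_{s\in S}\alpha_s\times\prod_{t\in T}d\alpha_t ,$$ indexed by all quadruples $(B,I,S,T)$ with $B$ a basis of $\mathcal{A}$, $E=EP(B)$, $I\subseteq IP(B)$, $S,T\subseteq IA(B)$ and $S\cap T=\varnothing$, where the factors of $\prod_{i\in I}d\alpha_i$ and of $\prod_{t\in T}d\alpha_t$ are taken in increasing order, are pairwise distinct and form a basis of the complex vector space $I_{\mathcal{A}}^\perp$. -/

import Mathlib

open scoped TensorProduct

noncomputable section

namespace Superspace

variable {n : ℕ}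

/-- Superspace of rank `n`: the polynomial ring in `x₁, …, xₙ` tensored with the exterior algebra on
the `n`-dimensional space with basis `θ₁, …, θₙ`. The bosonic variables commute with everything, so the
product is that of the usual tensor product of algebras. -/
abbrev Omega (n : ℕ) : Type :=
  MvPolynomial (Fin n) ℂ ⊗[ℂ] ExteriorAlgebra ℂ (Fin n → ℂ)

/-- A polynomial in the bosonic variables, as an element of superspace. -/
def bos : MvPolynomial (Fin n) ℂ →ₐ[ℂ] Omega n :=
  Algebra.TensorProduct.includeLeft

/-- The fermionic variable `θᵢ`. -/
def theta (i : Fin n) : Omega n :=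
  1 ⊗ₜ[ℂ] ExteriorAlgebra.ι ℂ (Pi.single i 1 : Fin n → ℂ)

/-- The partial derivative `∂/∂xᵢ` of polynomials, as a linear operator. -/
def partialX (i : Fin n) : Module.End ℂ (MvPolynomial (Fin n) ℂ) :=
  (MvPolynomial.pderiv i).toLinearMap

theorem partialX_commute (i j : Fin n) : Commute (partialX i) (partialX j) := by
  have h : ⁅MvPolynomial.pderiv (R := ℂ) i, MvPolynomial.pderiv (R := ℂ) j⁆ = 0 := by
    apply MvPolynomial.derivation_ext
    intro k
    rw [Derivation.commutator_apply]
    simp [MvPolynomial.pderiv_X, Pi.single_apply, apply_ite]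
  refine LinearMap.ext fun f => ?_
  have := congrArg (fun D => D f) h
  simp only [Derivation.commutator_apply, Derivation.zero_apply, sub_eq_zero] at this
  exact this

theorem partialX_pow_pairwise (s : Fin n →₀ ℕ) :
    ((Finset.univ : Finset (Fin n)) : Set (Fin n)).Pairwise
      (Function.onFun Commute fun i => partialX i ^ s i) :=
  fun i _ j _ _ => (partialX_commute i j).pow_pow _ _

/-- The differential operator `∂₁^{s₁} ⋯ ∂ₙ^{sₙ}` attached to an exponent vector `s`. -/
def monomialOp : Multiplicative (Fin n →₀ ℕ) →* Module.End ℂ (MvPolynomial (Fin n) ℂ) where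
  toFun s := Finset.univ.noncommProd (fun i => partialX i ^ (s.toAdd i))
    (partialX_pow_pairwise s.toAdd)
  map_one' :=
    (Finset.noncommProd_eq_pow_card _ _ _ 1 fun i _ => pow_zero (partialX i)).trans (one_pow _)
  map_mul' s t := by
    refine Eq.trans ?_ (Finset.noncommProd_mul_distrib _ _ (partialX_pow_pairwise s.toAdd)
      (partialX_pow_pairwise t.toAdd)
      fun i _ j _ _ => (partialX_commute i j).pow_pow _ _)
    exact Finset.noncommProd_congr rfl (fun i _ => pow_add _ _ _) _

/-- The algebra homomorphism `f ↦ f(∂₁, …, ∂ₙ)` from polynomials to operators on polynomials. -/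
def bosonicAction : MvPolynomial (Fin n) ℂ →ₐ[ℂ] Module.End ℂ (MvPolynomial (Fin n) ℂ) :=
  AddMonoidAlgebra.lift ℂ (Module.End ℂ (MvPolynomial (Fin n) ℂ)) (Fin n →₀ ℕ) monomialOp

/-- The contraction operator with respect to `∑ᵢ vᵢ θᵢ`. For `v` the `i`-th unit vector this is
`∂/∂θᵢ`, which maps `θ_{j₁} ⋯ θ_{j_r}` to `(-1)^(s-1) θ_{j₁} ⋯ θ̂_{j_s} ⋯ θ_{j_r}` if `j_s = i`, and to
`0` if `i` does not occur. -/
def contraction :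
    (Fin n → ℂ) →ₗ[ℂ] Module.End ℂ (ExteriorAlgebra ℂ (Fin n → ℂ)) :=
  CliffordAlgebra.contractLeft (Q := (0 : QuadraticForm ℂ (Fin n → ℂ))) ∘ₗ
    (dotProductEquiv ℂ (Fin n)).toLinearMap

/-- The algebra homomorphism `ω ↦ ω(∂/∂θ₁, …, ∂/∂θₙ)` from the exterior algebra to operators on it. -/
def fermionicAction :
    ExteriorAlgebra ℂ (Fin n → ℂ) →ₐ[ℂ] Module.End ℂ (ExteriorAlgebra ℂ (Fin n → ℂ)) :=
  ExteriorAlgebra.lift ℂ ⟨contraction, fun v => LinearMap.ext fun ω => by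
    exact CliffordAlgebra.contractLeft_contractLeft (dotProductEquiv ℂ (Fin n) v) ω⟩

/-- The algebra homomorphism `f ↦ ∂f = f(∂₁, …, ∂ₙ, ∂/∂θ₁, …, ∂/∂θₙ)` from superspace to operators on
superspace. -/
def diffOp : Omega n →ₐ[ℂ] Module.End ℂ (Omega n) :=
  (Module.endTensorEndAlgHom (R := ℂ) (S := ℂ) (A := ℂ)).comp
    (Algebra.TensorProduct.map bosonicAction fermionicAction)

/-- The action `f ⊙ g = ∂f(g)` of superspace on itself. -/
def odot (f g : Omega n) : Omega n := diffOp f g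

/-- The Macaulay inverse system `I^⊥` of an ideal `I`. -/
def inverseSystem (I : TwoSidedIdeal (Omega n)) : Submodule ℂ (Omega n) where
  carrier := {g | ∀ f ∈ I, odot f g = 0}
  zero_mem' f _ := by simp [odot]
  add_mem' hg hh f hf := by
    simp only [odot, map_add] at *
    rw [hg f hf, hh f hf, add_zero]
  smul_mem' c g hg f hf := by
    simp only [odot, map_smul] at *
    rw [hg f hf, smul_zero]

/-- The total derivative `df = ∑ᵢ (∂f/∂xᵢ) θᵢ`, the fermionic variables being treated as constants in
`∂f/∂xᵢ`. -/
def totalD (f : Omega n) : Omega n :=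
  ∑ i : Fin n, TensorProduct.map (partialX i) LinearMap.id f * theta i

/-- The linear form `v₁x₁ + ⋯ + vₙxₙ`. -/
def linearForm (v : Fin n → ℂ) : MvPolynomial (Fin n) ℂ :=
  ∑ i : Fin n, MvPolynomial.C (v i) * MvPolynomial.X i

/-- The zero set in `ℂⁿ` of the linear form `v₁x₁ + ⋯ + vₙxₙ`: a linear hyperplane if `v ≠ 0`, and the
whole space, a degenerate hyperplane (a loop), if `v = 0`. -/
def hyperplane (v : Fin n → ℂ) : Submodule ℂ (Fin n → ℂ) :=
  LinearMap.ker (dotProductEquiv ℂ (Fin n) v)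

/-! A multiarrangement is given by the family `a` of its normal vectors, indexed by a finite type. -/

variable {ι : Type*} [Fintype ι]

/-- The number, with multiplicity, of hyperplanes of the arrangement that do not contain `L`. -/
def rho (a : ι → Fin n → ℂ) (L : Submodule ℂ (Fin n → ℂ)) : ℕ :=
  Nat.card {i : ι // ¬ L ≤ hyperplane (a i)}

/-- The ideal of superspace generated by `λ_L^{ρ(L)+1}` and `d(λ_L^{ρ(L)+1})`, where `L = ℂℓ` runs over
all lines through the origin of `ℂⁿ` and `λ_L = ℓ₁x₁ + ⋯ + ℓₙxₙ`. -/
def superpowerIdeal (a : ι → Fin n → ℂ) : TwoSidedIdeal (Omega n) :=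
  TwoSidedIdeal.span
    {f | ∃ l : Fin n → ℂ, l ≠ 0 ∧
      (f = bos (linearForm l ^ (rho a (Submodule.span ℂ {l}) + 1)) ∨
        f = totalD (bos (linearForm l ^ (rho a (Submodule.span ℂ {l}) + 1))))}

/-- `B` is a basis of the arrangement: the normal vectors indexed by `B` form a basis of the span of all
normal vectors. -/
def IsBasis (a : ι → Fin n → ℂ) (B : Finset ι) : Prop :=
  LinearIndepOn ℂ a (B : Set ι) ∧
    Submodule.span ℂ (a '' (B : Set ι)) = Submodule.span ℂ (Set.range a)

variable [LinearOrder ι]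

/-- The lexicographic order on subsets of the same size: at the first place where the increasing
enumerations of `S` and `T` differ, that of `S` has the smaller entry. Equivalently, the least element
that lies in exactly one of `S` and `T` lies in `S`. -/
def LexLE (S T : Finset ι) : Prop :=
  S = T ∨ ∃ i ∈ S, i ∉ T ∧ ∀ j < i, (j ∈ S ↔ j ∈ T)

/-- `h` is externally active with respect to the basis `B`: it is not in `B`, and `B` is the
lexicographically largest basis contained in `B ∪ {h}`. -/
def ExternallyActive (a : ι → Fin n → ℂ) (B : Finset ι) (h : ι) : Prop :=
  h ∉ B ∧ ∀ B' : Finset ι, IsBasis a B' → B' ⊆ insert h B → LexLE B' B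

/-- `h` is internally active with respect to the basis `B`: it is in `B`, and `B` is the
lexicographically smallest basis containing `B \ {h}`. -/
def InternallyActive (a : ι → Fin n → ℂ) (B : Finset ι) (h : ι) : Prop :=
  h ∈ B ∧ ∀ B' : Finset ι, IsBasis a B' → B.erase h ⊆ B' → LexLE B B'

open Classical in
/-- The set of externally passive elements: those outside `B` that are not externally active. -/
def EP (a : ι → Fin n → ℂ) (B : Finset ι) : Finset ι :=
  {h | h ∉ B ∧ ¬ ExternallyActive a B h}

open Classical in
/-- The set of internally active elements. -/
def IA (a : ι → Fin n → ℂ) (B : Finset ι) : Finset ι :=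
  {h | InternallyActive a B h}

open Classical in
/-- The set of internally passive elements: those in `B` that are not internally active. -/
def IP (a : ι → Fin n → ℂ) (B : Finset ι) : Finset ι :=
  {h | h ∈ B ∧ ¬ InternallyActive a B h}

/-- The product of the linear forms `α_e`, `e ∈ E`. -/
def prodForm (a : ι → Fin n → ℂ) (E : Finset ι) : Omega n :=
  bos (∏ e ∈ E, linearForm (a e))

/-- The product of the differentials `dα_i`, `i ∈ I`, in increasing order of the index. -/
def prodDForm (a : ι → Fin n → ℂ) (I : Finset ι) : Omega n :=
  ((I.sort (· ≤ ·)).map fun i => totalD (bos (linearForm (a i)))).prod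

/-- The index set of the family: a basis `B` of the arrangement, a set `I` of internally passive
elements, and disjoint sets `S`, `T` of internally active elements. -/
structure Index (a : ι → Fin n → ℂ) where
  B : Finset ι
  I : Finset ι
  S : Finset ι
  T : Finset ι
  isBasis : IsBasis a B
  I_subset : I ⊆ IP a B
  S_subset : S ⊆ IA a B
  T_subset : T ⊆ IA a B
  disjoint : Disjoint S T

/-- The product `∏_E α_e · ∏_I dα_i · ∏_S α_s · ∏_T dα_t`, where `E` is the set of externally passive
elements of `B`. -/
def element (a : ι → Fin n → ℂ) (τ : Index a) : Omega n :=
  prodForm a (EP a τ.B) * prodDForm a τ.I * prodForm a τ.S * prodDForm a τ.T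

end Superspace

end

open scoped TensorProduct

noncomputable section

/-! The first half of the argument is combinatorial. Sending `(B, I, S, T)` to `(B \ S, I ∪ T)`
identifies the quadruples with the pairs `(C, T)` where `C` is an independent set and `T ⊆ C`: every
independent set is uniquely a basis minus some of its internally active elements
(`exists_isBasis_sdiff`, `mem_iff_of_subset_IA`), and `I`, `T` are told apart by internal activity.
Moreover `EP(B) ∪ S` depends only on `C = B \ S`: it consists of the elements outside `C` that are
not spanned by the larger elements of `C` (`passiveSet_sdiff`). So up to sign the products are the
elements `passiveElement`.

The second half is algebraic. Since `λ_L` and `dλ_L` act as a directional derivative and a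
contraction, the inverse system consists of the elements whose degree along each `l` is at most the
number of forms nonzero at `l` (`inverseSystem_superpowerIdeal`). That the passive elements form a
basis of this space is proved by deletion and contraction of the largest remaining element `m`.
Multiplication by `α_m` embeds the space of the deletion, and restriction to the hyperplane `α_m =
0` maps onto that of the contraction; the independent sets split in the same way into those avoiding
and those containing `m`.

To avoid changing the ambient space, the contracted elements are collected in a set `K`, and
everything is taken modulo elements whose bosonic coefficients vanish on the common zero set `flat a
K`. Fermionic variables are not restricted; when no form is left, the elements are constant in the
bosonic variables and killed by contractions along the flat, which leaves the exterior algebra on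
the forms in `K` (`mem_wedgeSpan_of_contraction_eq_zero`). The two halves of the induction are
`degreeBounded_le_passiveSpan_sup` and `passiveElement_coeff_eq_zero`. -/

namespace Superspace

/-! ### Directional derivatives and contractions as the action of linear forms and their
differentials. -/

section Operators

variable {n : ℕ}

open MvPolynomial

/-- The derivative in direction `l` of polynomials. -/
def dirDeriv (l : Fin n → ℂ) :
    Derivation ℂ (MvPolynomial (Fin n) ℂ) (MvPolynomial (Fin n) ℂ) :=
  mkDerivation ℂ fun i => C (l i)

@[simp] theorem dirDeriv_X (l : Fin n → ℂ) (i : Fin n) : dirDeriv l (X i) = C (l i) := by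
  simp [dirDeriv]

@[simp] theorem dirDeriv_linearForm (l v : Fin n → ℂ) :
    dirDeriv l (linearForm v) = C (v ⬝ᵥ l) := by
  simp [linearForm, dotProduct, Derivation.leibniz, dirDeriv]

@[simp] theorem eval_linearForm (v w : Fin n → ℂ) : eval w (linearForm v) = v ⬝ᵥ w := by
  simp [linearForm, dotProduct]

/-- The fermionic linear form `∑ᵢ vᵢ θᵢ`. -/
def thetaForm (v : Fin n → ℂ) : Omega n := 1 ⊗ₜ[ℂ] ExteriorAlgebra.ι ℂ v

theorem bosonicAction_X (i : Fin n) : bosonicAction (X i) = partialX i := by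
  have h : bosonicAction (X i) = monomialOp (Multiplicative.ofAdd (Finsupp.single i 1)) := by
    simp only [bosonicAction]
    exact (AddMonoidAlgebra.lift_single _ _ _).trans (one_smul _ _)
  rw [h]
  refine (Finset.mul_noncommProd_erase Finset.univ (Finset.mem_univ i)
    (fun j => partialX j ^ (Finsupp.single i 1 j)) (partialX_pow_pairwise _)).symm.trans ?_
  refine (congrArg₂ (· * ·) ?_ (Finset.noncommProd_eq_pow_card _ _ _ 1 ?_)).trans
    ((congrArg _ (one_pow _)).trans (mul_one (partialX i)))
  · rw [Finsupp.single_eq_same, pow_one]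
  · intro j hj
    rw [Finsupp.single_eq_of_ne (Finset.ne_of_mem_erase hj), pow_zero]

theorem bosonicAction_linearForm (l : Fin n → ℂ) :
    bosonicAction (linearForm l) = (dirDeriv l).toLinearMap := by
  refine LinearMap.ext fun f => ?_
  simp only [linearForm, map_sum, ← smul_eq_C_mul, map_smul, bosonicAction_X, partialX,
    LinearMap.sum_apply, LinearMap.smul_apply, Derivation.coeFn_coe]
  induction f using MvPolynomial.induction_on with
  | C c => simp
  | add p q hp hq => simp only [map_add, smul_add, Finset.sum_add_distrib, hp, hq]
  | mul_X p i hp =>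
    simp only [Derivation.leibniz, smul_add, Finset.sum_add_distrib, dirDeriv_X, ← hp, pderiv_X,
      Pi.single_apply, smul_eq_mul, Finset.mul_sum, mul_ite, mul_one, mul_zero, smul_ite, smul_zero]
    simp [smul_eq_C_mul, mul_comm, mul_left_comm]

@[simp] theorem fermionicAction_ι (l : Fin n → ℂ) :
    fermionicAction (ExteriorAlgebra.ι ℂ l) = contraction l := by
  simp [fermionicAction]

theorem diffOp_tmul (p : MvPolynomial (Fin n) ℂ) (ω : ExteriorAlgebra ℂ (Fin n → ℂ)) :
    diffOp (p ⊗ₜ ω) = TensorProduct.map (bosonicAction p) (fermionicAction ω) := by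
  simp only [diffOp, AlgHom.comp_apply, Algebra.TensorProduct.map_tmul]
  rfl

/-- The derivative in direction `l` on superspace. -/
def derivX (l : Fin n → ℂ) : Module.End ℂ (Omega n) :=
  TensorProduct.map (dirDeriv l).toLinearMap LinearMap.id

/-- The contraction in direction `l` on superspace. -/
def derivTheta (l : Fin n → ℂ) : Module.End ℂ (Omega n) :=
  TensorProduct.map LinearMap.id (contraction l)

@[simp] theorem derivX_tmul (l : Fin n → ℂ) (p : MvPolynomial (Fin n) ℂ)
    (ω : ExteriorAlgebra ℂ (Fin n → ℂ)) : derivX l (p ⊗ₜ ω) = dirDeriv l p ⊗ₜ ω := rfl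

@[simp] theorem derivTheta_tmul (l : Fin n → ℂ) (p : MvPolynomial (Fin n) ℂ)
    (ω : ExteriorAlgebra ℂ (Fin n → ℂ)) :
    derivTheta l (p ⊗ₜ ω) = p ⊗ₜ contraction l ω := rfl

/-- As `diffOp` is multiplicative, this and `diffOp_thetaForm` determine how every generator of the
superpower ideal acts. -/
theorem diffOp_bos_linearForm (l : Fin n → ℂ) : diffOp (bos (linearForm l)) = derivX l := by
  rw [bos, Algebra.TensorProduct.includeLeft_apply, diffOp_tmul, bosonicAction_linearForm, map_one]
  rfl

theorem diffOp_thetaForm (l : Fin n → ℂ) : diffOp (thetaForm l) = derivTheta l := by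
  rw [thetaForm, diffOp_tmul, fermionicAction_ι, map_one]
  rfl

theorem bos_mul_tmul (p q : MvPolynomial (Fin n) ℂ) (ω : ExteriorAlgebra ℂ (Fin n → ℂ)) :
    bos p * (q ⊗ₜ ω) = (p * q) ⊗ₜ[ℂ] ω := by
  simp [bos]

theorem bos_C_mul (c : ℂ) (g : Omega n) : bos (C c) * g = c • g := by
  induction g using TensorProduct.induction_on with
  | zero => simp
  | tmul q ω => rw [bos_mul_tmul, ← smul_eq_C_mul, TensorProduct.smul_tmul']
  | add x y hx hy => rw [mul_add, hx, hy, smul_add]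

theorem commute_bos (p : MvPolynomial (Fin n) ℂ) (g : Omega n) : Commute (bos p) g := by
  induction g using TensorProduct.induction_on with
  | zero => exact Commute.zero_right _
  | tmul q ω => simp [bos, Commute, SemiconjBy, mul_comm]
  | add x y hx hy => exact hx.add_right hy

theorem totalD_bos (p : MvPolynomial (Fin n) ℂ) :
    totalD (bos p) = ∑ i, bos (pderiv i p) * theta i := by
  simp [totalD, bos, partialX]

theorem thetaForm_eq_sum (v : Fin n → ℂ) : thetaForm v = ∑ i, v i • theta i := by
  simp only [thetaForm, theta, ← TensorProduct.tmul_smul, ← TensorProduct.tmul_sum, ← map_smul,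
    ← map_sum]
  congr 2
  ext j
  simp [Finset.sum_apply, Pi.single_apply]

theorem pderiv_linearForm (v : Fin n → ℂ) (i : Fin n) : pderiv i (linearForm v) = C (v i) := by
  simp [linearForm, pderiv_X, Pi.single_apply]

theorem totalD_linearForm (v : Fin n → ℂ) : totalD (bos (linearForm v)) = thetaForm v := by
  rw [totalD_bos, thetaForm_eq_sum]
  refine Finset.sum_congr rfl fun i _ => ?_
  rw [pderiv_linearForm, bos_C_mul]

theorem totalD_linearForm_pow (v : Fin n → ℂ) (k : ℕ) :
    totalD (bos (linearForm v ^ (k + 1))) =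
      ((k + 1 : ℕ) : ℂ) • (bos (linearForm v) ^ k * thetaForm v) := by
  rw [totalD_bos, thetaForm_eq_sum, Finset.mul_sum, Finset.smul_sum]
  refine Finset.sum_congr rfl fun i _ => ?_
  have h : pderiv i (linearForm v ^ (k + 1)) =
      C ((k + 1 : ℕ) : ℂ) * (linearForm v ^ k * C (v i)) := by
    rw [pderiv_pow, pderiv_linearForm, map_natCast, mul_assoc, Nat.add_sub_cancel]
  rw [h, map_mul, mul_assoc, bos_C_mul, map_mul, mul_assoc, bos_C_mul, map_pow]

theorem thetaForm_mul_tmul (v : Fin n → ℂ) (q : MvPolynomial (Fin n) ℂ)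
    (ω : ExteriorAlgebra ℂ (Fin n → ℂ)) :
    thetaForm v * (q ⊗ₜ ω) = q ⊗ₜ[ℂ] (ExteriorAlgebra.ι ℂ v * ω) := by
  simp [thetaForm]

theorem derivX_bos_mul (l : Fin n → ℂ) (p : MvPolynomial (Fin n) ℂ) (g : Omega n) :
    derivX l (bos p * g) = bos p * derivX l g + bos (dirDeriv l p) * g := by
  induction g using TensorProduct.induction_on with
  | zero => simp
  | tmul q ω =>
    simp only [bos_mul_tmul, derivX_tmul, Derivation.leibniz, smul_eq_mul, TensorProduct.add_tmul]
    rw [mul_comm q]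
  | add x y hx hy => simp only [mul_add, map_add, hx, hy]; abel

theorem derivX_thetaForm_mul (l v : Fin n → ℂ) (g : Omega n) :
    derivX l (thetaForm v * g) = thetaForm v * derivX l g := by
  induction g using TensorProduct.induction_on with
  | zero => simp
  | tmul q ω => simp [thetaForm_mul_tmul]
  | add x y hx hy => simp only [mul_add, map_add, hx, hy]

theorem derivTheta_bos_mul (l : Fin n → ℂ) (p : MvPolynomial (Fin n) ℂ) (g : Omega n) :
    derivTheta l (bos p * g) = bos p * derivTheta l g := by
  induction g using TensorProduct.induction_on with
  | zero => simp
  | tmul q ω => simp [bos_mul_tmul]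
  | add x y hx hy => simp only [mul_add, map_add, hx, hy]

theorem contraction_ι_mul (l v : Fin n → ℂ) (ω : ExteriorAlgebra ℂ (Fin n → ℂ)) :
    contraction l (ExteriorAlgebra.ι ℂ v * ω) =
      (v ⬝ᵥ l) • ω - ExteriorAlgebra.ι ℂ v * contraction l ω := by
  rw [dotProduct_comm]
  exact CliffordAlgebra.contractLeft_ι_mul (Q := (0 : QuadraticForm ℂ (Fin n → ℂ))) _ v ω

theorem contraction_one (l : Fin n → ℂ) :
    contraction l (1 : ExteriorAlgebra ℂ (Fin n → ℂ)) = 0 :=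
  CliffordAlgebra.contractLeft_one (Q := (0 : QuadraticForm ℂ (Fin n → ℂ))) _

theorem derivTheta_thetaForm_mul (l v : Fin n → ℂ) (g : Omega n) :
    derivTheta l (thetaForm v * g) = (v ⬝ᵥ l) • g - thetaForm v * derivTheta l g := by
  induction g using TensorProduct.induction_on with
  | zero => simp
  | tmul q ω =>
    simp [thetaForm_mul_tmul, contraction_ι_mul, TensorProduct.tmul_sub]
  | add x y hx hy => simp only [mul_add, map_add, hx, hy, smul_add]; abel

/-- The commutator of `derivX l` with multiplication by the form `v` is the scalar `v ⬝ᵥ l`, so this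
is the usual Weyl algebra identity. -/
theorem derivX_pow_bos_mul (l v : Fin n → ℂ) (k : ℕ) (g : Omega n) :
    (derivX l ^ (k + 1)) (bos (linearForm v) * g) =
      bos (linearForm v) * (derivX l ^ (k + 1)) g
        + ((k + 1 : ℕ) * (v ⬝ᵥ l)) • (derivX l ^ k) g := by
  induction k with
  | zero => simp only [zero_add, pow_one, derivX_bos_mul, dirDeriv_linearForm, bos_C_mul]; simp
  | succ k ih =>
    rw [pow_succ', Module.End.mul_apply, ih, map_add, derivX_bos_mul, map_smul,
      dirDeriv_linearForm, bos_C_mul, ← Module.End.mul_apply, ← pow_succ', ← Module.End.mul_apply,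
      ← pow_succ']
    push_cast
    module

theorem derivX_pow_bos_mul_of_eq_zero {l v : Fin n → ℂ} (h : v ⬝ᵥ l = 0) (k : ℕ) (g : Omega n) :
    (derivX l ^ k) (bos (linearForm v) * g) = bos (linearForm v) * (derivX l ^ k) g := by
  cases k with
  | zero => simp
  | succ k => rw [derivX_pow_bos_mul, h]; simp

theorem derivX_pow_thetaForm_mul (l v : Fin n → ℂ) (k : ℕ) (g : Omega n) :
    (derivX l ^ k) (thetaForm v * g) = thetaForm v * (derivX l ^ k) g := by
  induction k with
  | zero => simp
  | succ k ih => rw [pow_succ', Module.End.mul_apply, ih, derivX_thetaForm_mul]; rfl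

/-- Every element of superspace is killed by a power of `derivX l`. -/
theorem exists_derivX_pow_eq_zero (l : Fin n → ℂ) (g : Omega n) : ∃ k, (derivX l ^ k) g = 0 := by
  have hmono {g : Omega n} {k m : ℕ} (hkm : k ≤ m) (h : (derivX l ^ k) g = 0) :
      (derivX l ^ m) g = 0 := by
    obtain ⟨j, rfl⟩ := Nat.exists_eq_add_of_le hkm
    rw [add_comm, pow_add, Module.End.mul_apply, h, map_zero]
  have hadd {g h : Omega n} (hg : ∃ k, (derivX l ^ k) g = 0) (hh : ∃ k, (derivX l ^ k) h = 0) :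
      ∃ k, (derivX l ^ k) (g + h) = 0 := by
    obtain ⟨k, hk⟩ := hg
    obtain ⟨m, hm⟩ := hh
    exact ⟨max k m, by rw [map_add, hmono (le_max_left k m) hk, hmono (le_max_right k m) hm,
      add_zero]⟩
  induction g using TensorProduct.induction_on with
  | zero => exact ⟨0, by simp⟩
  | tmul q ω =>
    induction q using MvPolynomial.induction_on with
    | C c => exact ⟨1, by simp [dirDeriv]⟩
    | add p q hp hq => rw [TensorProduct.add_tmul]; exact hadd hp hq
    | mul_X p i hp =>
      obtain ⟨k, hk⟩ := hp
      refine ⟨k + 1, ?_⟩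
      have hX : (X i : MvPolynomial (Fin n) ℂ) = linearForm (Pi.single i 1) := by
        simp [linearForm, Pi.single_apply]
      rw [mul_comm, ← bos_mul_tmul, hX, derivX_pow_bos_mul, hmono (Nat.le_succ k) hk, hk]
      simp
  | add x y hx hy => exact hadd hx hy

end Operators

/-! ### Elements whose bosonic coefficients vanish on a linear subspace. -/

section Vanishing

variable {n : ℕ}

open MvPolynomial

/-- The restriction of a polynomial to the line `t ↦ w + t l`. -/
def alongLine (w l : Fin n → ℂ) : MvPolynomial (Fin n) ℂ →ₐ[ℂ] Polynomial ℂ :=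
  aeval fun i => Polynomial.C (w i) + Polynomial.C (l i) * Polynomial.X

theorem eval_alongLine (w l : Fin n → ℂ) (t : ℂ) (p : MvPolynomial (Fin n) ℂ) :
    (alongLine w l p).eval t = eval (w + t • l) p := by
  induction p using MvPolynomial.induction_on with
  | C c => simp [alongLine]
  | add p q hp hq => simp only [map_add, Polynomial.eval_add, hp, hq]
  | mul_X p i hp =>
    rw [map_mul, Polynomial.eval_mul, hp, map_mul]
    simp [alongLine, mul_comm t]

theorem derivative_alongLine (w l : Fin n → ℂ) (p : MvPolynomial (Fin n) ℂ) :
    Polynomial.derivative (alongLine w l p) = alongLine w l (dirDeriv l p) := by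
  induction p using MvPolynomial.induction_on with
  | C c => simp [alongLine]
  | add p q hp hq => simp only [map_add, hp, hq]
  | mul_X p i hp =>
    rw [map_mul, Polynomial.derivative_mul, hp, Derivation.leibniz, map_add, smul_eq_mul,
      smul_eq_mul, map_mul, map_mul, dirDeriv_X]
    simp only [alongLine, aeval_X, aeval_C, Polynomial.derivative_add, Polynomial.derivative_C,
      Polynomial.derivative_C_mul_X, Polynomial.algebraMap_eq]
    ring

/-- Evaluation of the bosonic variables at a point. -/
def evalAt (w : Fin n → ℂ) : Omega n →ₗ[ℂ] ExteriorAlgebra ℂ (Fin n → ℂ) :=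
  (TensorProduct.lid ℂ _).toLinearMap ∘ₗ
    TensorProduct.map (aeval w : MvPolynomial (Fin n) ℂ →ₐ[ℂ] ℂ).toLinearMap LinearMap.id

@[simp] theorem evalAt_tmul (w : Fin n → ℂ) (p : MvPolynomial (Fin n) ℂ)
    (ω : ExteriorAlgebra ℂ (Fin n → ℂ)) : evalAt w (p ⊗ₜ ω) = eval w p • ω := by
  simp [evalAt, aeval_eq_eval]

/-- The polynomial obtained by applying a linear functional to the fermionic part. -/
def coeffOf (φ : Module.Dual ℂ (ExteriorAlgebra ℂ (Fin n → ℂ))) :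
    Omega n →ₗ[ℂ] MvPolynomial (Fin n) ℂ :=
  (TensorProduct.rid ℂ _).toLinearMap ∘ₗ TensorProduct.map LinearMap.id φ

@[simp] theorem coeffOf_tmul (φ : Module.Dual ℂ (ExteriorAlgebra ℂ (Fin n → ℂ)))
    (p : MvPolynomial (Fin n) ℂ) (ω : ExteriorAlgebra ℂ (Fin n → ℂ)) :
    coeffOf φ (p ⊗ₜ ω) = φ ω • p := by
  simp [coeffOf]

theorem eval_coeffOf (φ : Module.Dual ℂ (ExteriorAlgebra ℂ (Fin n → ℂ))) (w : Fin n → ℂ)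
    (g : Omega n) : eval w (coeffOf φ g) = φ (evalAt w g) := by
  induction g using TensorProduct.induction_on with
  | zero => simp
  | tmul q ω => simp [smul_eval, mul_comm]
  | add x y hx hy => simp only [map_add, hx, hy]

theorem coeffOf_derivX (φ : Module.Dual ℂ (ExteriorAlgebra ℂ (Fin n → ℂ))) (l : Fin n → ℂ)
    (g : Omega n) : coeffOf φ (derivX l g) = dirDeriv l (coeffOf φ g) := by
  induction g using TensorProduct.induction_on with
  | zero => simp
  | tmul q ω => simp
  | add x y hx hy => simp only [map_add, hx, hy]

theorem coeffOf_bos_mul (φ : Module.Dual ℂ (ExteriorAlgebra ℂ (Fin n → ℂ)))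
    (p : MvPolynomial (Fin n) ℂ) (g : Omega n) : coeffOf φ (bos p * g) = p * coeffOf φ g := by
  induction g using TensorProduct.induction_on with
  | zero => simp
  | tmul q ω => simp [bos_mul_tmul]
  | add x y hx hy => simp only [mul_add, map_add, hx, hy]

theorem evalAt_bos_mul (w : Fin n → ℂ) (p : MvPolynomial (Fin n) ℂ) (g : Omega n) :
    evalAt w (bos p * g) = eval w p • evalAt w g := by
  induction g using TensorProduct.induction_on with
  | zero => simp
  | tmul q ω => simp [bos_mul_tmul, mul_smul]
  | add x y hx hy => simp only [mul_add, map_add, smul_add, hx, hy]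

theorem evalAt_derivTheta (w l : Fin n → ℂ) (g : Omega n) :
    evalAt w (derivTheta l g) = contraction l (evalAt w g) := by
  induction g using TensorProduct.induction_on with
  | zero => simp
  | tmul q ω => simp
  | add x y hx hy => simp only [map_add, hx, hy]

/-- Functionals on the exterior algebra reduce identities in superspace to identities between scalar
polynomials, which are then tested on lines. -/
theorem eq_of_dual {ω η : ExteriorAlgebra ℂ (Fin n → ℂ)}
    (h : ∀ φ : Module.Dual ℂ (ExteriorAlgebra ℂ (Fin n → ℂ)), φ ω = φ η) : ω = η := by
  rw [← sub_eq_zero, ← Module.forall_dual_apply_eq_zero_iff ℂ]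
  intro φ
  rw [map_sub, h, sub_self]

/-- The elements of superspace whose bosonic coefficients vanish on `W`. -/
def vanishing (W : Submodule ℂ (Fin n → ℂ)) : Submodule ℂ (Omega n) :=
  ⨅ w ∈ W, LinearMap.ker (evalAt w)

theorem mem_vanishing {W : Submodule ℂ (Fin n → ℂ)} {g : Omega n} :
    g ∈ vanishing W ↔ ∀ w ∈ W, evalAt w g = 0 := by
  simp [vanishing, Submodule.mem_iInf]

theorem vanishing_anti {W W' : Submodule ℂ (Fin n → ℂ)} (h : W ≤ W') :
    vanishing W' ≤ vanishing W := fun _ hg =>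
  mem_vanishing.2 fun w hw => mem_vanishing.1 hg w (h hw)

theorem vanishing_top : vanishing (⊤ : Submodule ℂ (Fin n → ℂ)) = ⊥ := by
  classical
  refine eq_bot_iff.2 fun g hg => ?_
  have h (φ : Module.Dual ℂ (ExteriorAlgebra ℂ (Fin n → ℂ))) : coeffOf φ g = 0 := by
    refine MvPolynomial.funext fun w => ?_
    rw [eval_coeffOf, mem_vanishing.1 hg w trivial, map_zero, map_zero]
  let b := Module.Basis.ofVectorSpace ℂ (ExteriorAlgebra ℂ (Fin n → ℂ))
  have hb (g : Omega n) (k) :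
      TensorProduct.equivFinsuppOfBasisRight b g k = coeffOf (b.coord k) g := by
    induction g using TensorProduct.induction_on with
    | zero => simp
    | tmul q ω => simp
    | add x y hx hy => simp only [map_add, Finsupp.add_apply, hx, hy]
  rw [Submodule.mem_bot, ← (TensorProduct.equivFinsuppOfBasisRight b).map_eq_zero_iff]
  ext1 k
  rw [hb, h, Finsupp.zero_apply]

/-- The direction is tangent to `W`: a line through a point of `W` in direction `l` stays in `W`, so
the restricted coefficient is the zero polynomial and so is its derivative. -/
theorem derivX_mem_vanishing {W : Submodule ℂ (Fin n → ℂ)} {l : Fin n → ℂ} (hl : l ∈ W)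
    {g : Omega n} (hg : g ∈ vanishing W) : derivX l g ∈ vanishing W := by
  refine mem_vanishing.2 fun w hw => eq_of_dual fun φ => ?_
  have h : alongLine w l (coeffOf φ g) = 0 := by
    refine Polynomial.funext fun t => ?_
    rw [eval_alongLine, eval_coeffOf,
      mem_vanishing.1 hg _ (W.add_mem hw (W.smul_mem t hl)), map_zero, Polynomial.eval_zero]
  have h' := eval_alongLine w l 0 (dirDeriv l (coeffOf φ g))
  rw [← derivative_alongLine, h, zero_smul, add_zero, ← coeffOf_derivX, eval_coeffOf] at h'
  simpa using h'.symm

theorem derivX_pow_mem_vanishing {W : Submodule ℂ (Fin n → ℂ)} {l : Fin n → ℂ} (hl : l ∈ W)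
    {g : Omega n} (hg : g ∈ vanishing W) (k : ℕ) : (derivX l ^ k) g ∈ vanishing W := by
  induction k with
  | zero => simpa
  | succ k ih => rw [pow_succ']; exact derivX_mem_vanishing hl ih

theorem derivTheta_mem_vanishing {W : Submodule ℂ (Fin n → ℂ)} (l : Fin n → ℂ)
    {g : Omega n} (hg : g ∈ vanishing W) : derivTheta l g ∈ vanishing W := by
  refine mem_vanishing.2 fun w hw => ?_
  rw [evalAt_derivTheta, mem_vanishing.1 hg w hw, map_zero]

theorem bos_mul_mem_vanishing {W : Submodule ℂ (Fin n → ℂ)} (p : MvPolynomial (Fin n) ℂ)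
    {g : Omega n} (hg : g ∈ vanishing W) : bos p * g ∈ vanishing W := by
  refine mem_vanishing.2 fun w hw => ?_
  rw [evalAt_bos_mul, mem_vanishing.1 hg w hw, smul_zero]

/-- A linear form that does not vanish identically on `W` is a nonzerodivisor modulo the elements
vanishing on `W`. -/
theorem mem_vanishing_of_linearForm_mul_mem {W : Submodule ℂ (Fin n → ℂ)} {v w₀ : Fin n → ℂ}
    (hw₀ : w₀ ∈ W) (hv : v ⬝ᵥ w₀ ≠ 0) {g : Omega n}
    (hg : bos (linearForm v) * g ∈ vanishing W) : g ∈ vanishing W := by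
  refine mem_vanishing.2 fun w hw => eq_of_dual fun φ => ?_
  -- Restriction to the line through `w` in direction `w₀` leads to one-variable polynomials, a
  -- domain, and there the form is not constant.
  have h : alongLine w w₀ (linearForm v) * alongLine w w₀ (coeffOf φ g) = 0 := by
    refine Polynomial.funext fun t => ?_
    rw [← map_mul, ← coeffOf_bos_mul, eval_alongLine, eval_coeffOf,
      mem_vanishing.1 hg _ (W.add_mem hw (W.smul_mem t hw₀)), map_zero, Polynomial.eval_zero]
  have hne : alongLine w w₀ (linearForm v) ≠ 0 := by
    intro h0
    have h1 := eval_alongLine w w₀ 1 (linearForm v)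
    have h2 := eval_alongLine w w₀ 0 (linearForm v)
    rw [h0, eval_linearForm, Polynomial.eval_zero, dotProduct_add] at h1 h2
    simp only [one_smul, zero_smul, dotProduct_zero, add_zero] at h1 h2
    rw [← h2, zero_add] at h1
    exact hv h1.symm
  have h' := eval_alongLine w w₀ 0 (coeffOf φ g)
  rw [(mul_eq_zero.1 h).resolve_left hne, zero_smul, add_zero, eval_coeffOf] at h'
  simpa using h'.symm

/-- Elements vanishing on a hyperplane section of `W` are multiples of the linear form defining it,
up to elements vanishing on `W`. -/
theorem exists_sub_linearForm_mul_mem_vanishing {W W' : Submodule ℂ (Fin n → ℂ)}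
    {v w₀ : Fin n → ℂ} (hw₀ : w₀ ∈ W) (hv : v ⬝ᵥ w₀ ≠ 0)
    (hW' : ∀ w ∈ W, v ⬝ᵥ w = 0 → w ∈ W') {g : Omega n} (hg : g ∈ vanishing W') :
    ∃ g', g - bos (linearForm v) * g' ∈ vanishing W := by
  set u : Fin n → ℂ := (v ⬝ᵥ w₀)⁻¹ • w₀ with hu
  have huW : u ∈ W := W.smul_mem _ hw₀
  have hvu : v ⬝ᵥ u = 1 := by simp [hu, hv]
  -- Here `σ` is pullback along the projection `w ↦ w - (v ⬝ᵥ w) u` onto the kernel of the form.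
  -- This projection sends `W` into `W'`, so `τ g` vanishes on `W`, while `g - τ g` is divisible by
  -- the form.
  let σ : MvPolynomial (Fin n) ℂ →ₐ[ℂ] MvPolynomial (Fin n) ℂ :=
    aeval fun i => X i - C (u i) * linearForm v
  have hσ (p : MvPolynomial (Fin n) ℂ) (w : Fin n → ℂ) :
      eval w (σ p) = eval (w - (v ⬝ᵥ w) • u) p := by
    induction p using MvPolynomial.induction_on with
    | C c => simp [σ]
    | add p q hp hq => simp only [map_add, hp, hq]
    | mul_X p i hp => rw [map_mul, map_mul, hp, map_mul]; simp [σ, mul_comm]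
  have hdvd (p : MvPolynomial (Fin n) ℂ) : linearForm v ∣ p - σ p := by
    induction p using MvPolynomial.induction_on with
    | C c => simp [σ]
    | add p q hp hq => rw [map_add, add_sub_add_comm]; exact dvd_add hp hq
    | mul_X p i hp =>
      have : p * X i - σ (p * X i) =
          (p - σ p) * X i + σ p * (C (u i) * linearForm v) := by
        rw [map_mul, show σ (X i) = X i - C (u i) * linearForm v by simp [σ]]
        ring
      rw [this]
      exact dvd_add (hp.mul_right _) ((dvd_mul_left _ _).mul_left _)
  let τ : Omega n →ₗ[ℂ] Omega n := TensorProduct.map σ.toLinearMap LinearMap.id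
  have hτ (w : Fin n → ℂ) (g : Omega n) : evalAt w (τ g) = evalAt (w - (v ⬝ᵥ w) • u) g := by
    induction g using TensorProduct.induction_on with
    | zero => simp
    | tmul q ω => simp [τ, hσ]
    | add x y hx hy => simp only [map_add, hx, hy]
  have hex (g : Omega n) : ∃ g', g - τ g = bos (linearForm v) * g' := by
    induction g using TensorProduct.induction_on with
    | zero => exact ⟨0, by simp⟩
    | tmul q ω =>
      obtain ⟨r, hr⟩ := hdvd q
      refine ⟨r ⊗ₜ ω, ?_⟩
      rw [bos_mul_tmul, ← hr, TensorProduct.sub_tmul]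
      rfl
    | add x y hx hy =>
      obtain ⟨x', hx⟩ := hx
      obtain ⟨y', hy⟩ := hy
      exact ⟨x' + y', by rw [map_add, mul_add, ← hx, ← hy]; abel⟩
  obtain ⟨g', hg'⟩ := hex g
  refine ⟨g', mem_vanishing.2 fun w hw => ?_⟩
  rw [← hg', sub_sub_cancel, hτ]
  refine mem_vanishing.1 hg _ (hW' _ (W.sub_mem hw (W.smul_mem _ huW)) ?_)
  simp [hvu]

/-- Modulo elements vanishing on `W`, an element killed by all derivatives along `W` is constant. -/
theorem sub_one_tmul_evalAt_mem_vanishing {W : Submodule ℂ (Fin n → ℂ)} {g : Omega n}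
    (hg : ∀ l ∈ W, derivX l g ∈ vanishing W) : g - 1 ⊗ₜ evalAt 0 g ∈ vanishing W := by
  refine mem_vanishing.2 fun w hw => ?_
  rw [map_sub, evalAt_tmul, map_one, one_smul, sub_eq_zero]
  refine eq_of_dual fun φ => ?_
  have h : Polynomial.derivative (alongLine 0 w (coeffOf φ g)) = 0 := by
    refine Polynomial.funext fun t => ?_
    rw [derivative_alongLine, eval_alongLine, ← coeffOf_derivX, eval_coeffOf, zero_add,
      mem_vanishing.1 (hg w hw) _ (W.smul_mem t hw), map_zero, Polynomial.eval_zero]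
  have h0 := eval_alongLine 0 w 0 (coeffOf φ g)
  have h1 := eval_alongLine 0 w 1 (coeffOf φ g)
  rw [Polynomial.eq_C_of_derivative_eq_zero h, Polynomial.eval_C, eval_coeffOf] at h0 h1
  simp only [one_smul, zero_smul, zero_add] at h0 h1
  rw [← h0, ← h1]

end Vanishing

/-! ### Flats, wedge products of the forms, and contractions along a flat. -/

section Exterior

variable {n : ℕ} {ι : Type*}

/-- A vector outside a subspace is separated from it by a vector, through the dot product. -/
theorem exists_dotProduct_eq_one {S : Submodule ℂ (Fin n → ℂ)} {v : Fin n → ℂ} (hv : v ∉ S) :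
    ∃ l, v ⬝ᵥ l = 1 ∧ ∀ u ∈ S, u ⬝ᵥ l = 0 := by
  obtain ⟨f, hf, hS⟩ := Submodule.exists_le_ker_of_notMem hv
  obtain ⟨l, rfl⟩ := (dotProductEquiv ℂ (Fin n)).surjective f
  have h (u : Fin n → ℂ) : dotProductEquiv ℂ (Fin n) l u = u ⬝ᵥ l := dotProduct_comm l u
  rw [h] at hf
  refine ⟨(v ⬝ᵥ l)⁻¹ • l, by simp [hf], fun u hu => ?_⟩
  have h0 := LinearMap.mem_ker.1 (hS hu)
  rw [h] at h0
  simp [h0]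

/-- The common zero set of the linear forms indexed by `K`. -/
def flat (a : ι → Fin n → ℂ) (K : Set ι) : Submodule ℂ (Fin n → ℂ) :=
  ⨅ k ∈ K, hyperplane (a k)

theorem mem_hyperplane {v l : Fin n → ℂ} : l ∈ hyperplane v ↔ v ⬝ᵥ l = 0 := Iff.rfl

theorem mem_flat {a : ι → Fin n → ℂ} {K : Set ι} {l : Fin n → ℂ} :
    l ∈ flat a K ↔ ∀ k ∈ K, a k ⬝ᵥ l = 0 := by
  simp [flat, Submodule.mem_iInf, mem_hyperplane]

theorem dotProduct_eq_zero_of_mem_span {a : ι → Fin n → ℂ} {K : Set ι} {v l : Fin n → ℂ}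
    (hl : l ∈ flat a K) (hv : v ∈ Submodule.span ℂ (a '' K)) : v ⬝ᵥ l = 0 := by
  have : Submodule.span ℂ (a '' K) ≤ LinearMap.ker (dotProductEquiv ℂ (Fin n) l) := by
    rw [Submodule.span_le]
    rintro _ ⟨k, hk, rfl⟩
    exact (dotProduct_comm _ _).trans (mem_flat.1 hl k hk)
  exact (dotProduct_comm _ _).trans (this hv)

/-- By duality, the span of the forms in `K` is exactly the set of forms vanishing on the flat of
`K`. -/
theorem exists_mem_flat {a : ι → Fin n → ℂ} {K : Set ι} {v : Fin n → ℂ}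
    (hv : v ∉ Submodule.span ℂ (a '' K)) : ∃ l ∈ flat a K, v ⬝ᵥ l = 1 := by
  obtain ⟨l, h1, h0⟩ := exists_dotProduct_eq_one hv
  exact ⟨l, mem_flat.2 fun k hk => h0 _ (Submodule.subset_span ⟨k, hk, rfl⟩), h1⟩

/-- The wedge product of the vectors indexed by a list. -/
def wedge (a : ι → Fin n → ℂ) (L : List ι) : ExteriorAlgebra ℂ (Fin n → ℂ) :=
  (L.map fun i => ExteriorAlgebra.ι ℂ (a i)).prod

@[simp] theorem wedge_nil (a : ι → Fin n → ℂ) : wedge a [] = 1 := rfl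

@[simp] theorem wedge_cons (a : ι → Fin n → ℂ) (i : ι) (L : List ι) :
    wedge a (i :: L) = ExteriorAlgebra.ι ℂ (a i) * wedge a L := by
  simp [wedge]

theorem wedge_append (a : ι → Fin n → ℂ) (L L' : List ι) :
    wedge a (L ++ L') = wedge a L * wedge a L' := by
  simp [wedge]

theorem ι_mul_ι (v w : Fin n → ℂ) :
    ExteriorAlgebra.ι ℂ v * ExteriorAlgebra.ι ℂ w =
      -(ExteriorAlgebra.ι ℂ w * ExteriorAlgebra.ι ℂ v) := by
  rw [eq_neg_iff_add_eq_zero, ExteriorAlgebra.ι_add_mul_swap]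

/-- Reordering the factors changes a wedge product only by a sign. -/
theorem wedge_perm (a : ι → Fin n → ℂ) {L L' : List ι} (h : L.Perm L') :
    ∃ c : ℂ, c ≠ 0 ∧ wedge a L = c • wedge a L' := by
  induction h with
  | nil => exact ⟨1, one_ne_zero, by simp⟩
  | cons i _ ih =>
    obtain ⟨c, hc, h⟩ := ih
    exact ⟨c, hc, by simp [h]⟩
  | swap i j L =>
    refine ⟨-1, by simp, ?_⟩
    rw [wedge_cons, wedge_cons, wedge_cons, wedge_cons, ← mul_assoc, ι_mul_ι, neg_mul, mul_assoc,
      neg_one_smul]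
  | trans _ _ ih ih' =>
    obtain ⟨c, hc, h⟩ := ih
    obtain ⟨c', hc', h'⟩ := ih'
    exact ⟨c * c', mul_ne_zero hc hc', by rw [h, h', smul_smul]⟩

theorem contraction_wedge {a : ι → Fin n → ℂ} {l : Fin n → ℂ} {L : List ι}
    (h : ∀ k ∈ L, a k ⬝ᵥ l = 0) : contraction l (wedge a L) = 0 := by
  induction L with
  | nil => exact contraction_one l
  | cons i L ih =>
    rw [wedge_cons, contraction_ι_mul, h i (by simp), ih fun k hk => h k (by simp [hk])]
    simp

variable [LinearOrder ι]

/-- Wedge products of subsets of a linearly independent family are linearly independent. -/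
theorem wedge_coeff_eq_zero {a : ι → Fin n → ℂ} {K : Finset ι} (hK : LinearIndepOn ℂ a (K : Set ι))
    {c : Finset ι → ℂ} (h : ∑ T ∈ K.powerset, c T • wedge a (T.sort (· ≤ ·)) = 0) :
    ∀ T ⊆ K, c T = 0 := by
  induction K using Finset.induction_on_min generalizing c with
  | empty =>
    intro T hT
    rw [Finset.subset_empty] at hT
    subst hT
    simpa using h
  | insert m K hm ih =>
    have hmK : m ∉ K := fun h => lt_irrefl _ (hm m h)
    have hsort (T : Finset ι) (hT : T ⊆ K) : (insert m T).sort (· ≤ ·) = m :: T.sort (· ≤ ·) :=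
      Finset.sort_insert (· ≤ ·) (fun b hb => (hm b (hT hb)).le) fun h => hmK (hT h)
    rw [Finset.coe_insert, linearIndepOn_insert (by simpa)] at hK
    -- Contraction with an `l` dual to `a m` and killing the forms in `K` strips the first factor
    -- `m` and annihilates the products without `m`, isolating the coefficients of the sets
    -- containing `m`.
    obtain ⟨l, hl, hml⟩ := exists_mem_flat hK.2
    have hcon (T : Finset ι) (hT : T ⊆ K) : contraction l (wedge a (T.sort (· ≤ ·))) = 0 :=
      contraction_wedge fun k hk => mem_flat.1 hl k (hT (by simpa using hk))
    rw [Finset.sum_powerset_insert hmK] at h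
    have h1 : ∀ T ⊆ K, c (insert m T) = 0 := by
      refine ih hK.1 (c := fun T => c (insert m T)) ?_
      have := congrArg (contraction l) h
      rw [map_add, map_sum, map_sum, map_zero] at this
      rw [Finset.sum_eq_zero fun T hT => by rw [map_smul, hcon T (Finset.mem_powerset.1 hT),
        smul_zero], zero_add] at this
      rw [← this]
      refine Finset.sum_congr rfl fun T hT => ?_
      rw [Finset.mem_powerset] at hT
      rw [hsort T hT, wedge_cons, map_smul, contraction_ι_mul, hcon T hT, hml]
      simp
    have h2 : ∀ T ⊆ K, c T = 0 := by
      refine ih hK.1 ?_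
      rwa [Finset.sum_eq_zero (s := K.powerset) (f := fun T => c (insert m T) • _) fun T hT => by
        rw [h1 T (Finset.mem_powerset.1 hT), zero_smul], add_zero] at h
    intro T hT
    by_cases hmT : m ∈ T
    · rw [← Finset.insert_erase hmT]
      exact h1 _ (Finset.subset_insert_iff.1 hT)
    · exact h2 T ((Finset.subset_insert_iff_of_notMem hmT).1 hT)

/-- The span of the wedge products of subsets of `K`. -/
def wedgeSpan (a : ι → Fin n → ℂ) (K : Finset ι) : Submodule ℂ (ExteriorAlgebra ℂ (Fin n → ℂ)) :=
  Submodule.span ℂ ((fun T : Finset ι => wedge a (T.sort (· ≤ ·))) '' {T | T ⊆ K})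

theorem ι_mul_mem_wedgeSpan {a : ι → Fin n → ℂ} {K : Finset ι} {v : Fin n → ℂ}
    (hv : v ∈ Submodule.span ℂ (a '' (K : Set ι))) {ω : ExteriorAlgebra ℂ (Fin n → ℂ)}
    (hω : ω ∈ wedgeSpan a K) : ExteriorAlgebra.ι ℂ v * ω ∈ wedgeSpan a K := by
  induction hv using Submodule.span_induction with
  | zero => simp
  | add x y _ _ hx hy => rw [map_add, add_mul]; exact add_mem hx hy
  | smul c x _ hx => rw [map_smul, smul_mul_assoc]; exact Submodule.smul_mem _ _ hx
  | mem x hx =>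
    obtain ⟨k, hk, rfl⟩ := hx
    induction hω using Submodule.span_induction with
    | zero => simp
    | add x y _ _ hx hy => rw [mul_add]; exact add_mem hx hy
    | smul c x _ hx => rw [mul_smul_comm]; exact Submodule.smul_mem _ _ hx
    | mem x hx =>
      obtain ⟨T, hT, rfl⟩ := hx
      by_cases hkT : k ∈ T
      · have hp : (T.sort (· ≤ ·)).Perm (k :: (T.erase k).sort (· ≤ ·)) := by
          rw [List.perm_ext_iff_of_nodup (Finset.sort_nodup _ _) (by simp)]
          intro i
          by_cases hi : i = k <;> simp [hi, hkT]
        obtain ⟨c, -, hc⟩ := wedge_perm a hp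
        simp only [hc, wedge_cons, mul_smul_comm, ← mul_assoc, ExteriorAlgebra.ι_sq_zero, zero_mul,
          smul_zero, zero_mem]
      · have hp : (k :: T.sort (· ≤ ·)).Perm ((insert k T).sort (· ≤ ·)) := by
          rw [List.perm_ext_iff_of_nodup (by simp [hkT]) (Finset.sort_nodup _ _)]
          intro i
          simp
        obtain ⟨c, -, hc⟩ := wedge_perm a hp
        simp only [← wedge_cons, hc]
        exact Submodule.smul_mem _ _ (Submodule.subset_span
          ⟨_, Finset.insert_subset hk hT, rfl⟩)

theorem map_mem_wedgeSpan {a : ι → Fin n → ℂ} {K : Finset ι} {p : (Fin n → ℂ) →ₗ[ℂ] (Fin n → ℂ)}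
    (hp : LinearMap.range p ≤ Submodule.span ℂ (a '' (K : Set ι)))
    (ω : ExteriorAlgebra ℂ (Fin n → ℂ)) : ExteriorAlgebra.map p ω ∈ wedgeSpan a K := by
  -- Stability of `wedgeSpan a K` under left multiplication is multiplicative in `ω`, unlike bare
  -- membership, so induction on `ω` goes through.
  suffices h : ∀ η ∈ wedgeSpan a K, ExteriorAlgebra.map p ω * η ∈ wedgeSpan a K by
    have := h 1 (Submodule.subset_span ⟨∅, Finset.empty_subset _, by simp⟩)
    rwa [mul_one] at this
  induction ω using ExteriorAlgebra.induction with
  | algebraMap r =>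
    intro η hη
    rw [AlgHom.commutes, ← Algebra.smul_def]
    exact Submodule.smul_mem _ _ hη
  | ι v =>
    intro η hη
    rw [ExteriorAlgebra.map_apply_ι]
    exact ι_mul_mem_wedgeSpan (hp ⟨v, rfl⟩) hη
  | mul x y hx hy =>
    intro η hη
    rw [map_mul, mul_assoc]
    exact hx _ (hy _ hη)
  | add x y hx hy =>
    intro η hη
    rw [map_add, add_mul]
    exact add_mem (hx _ hη) (hy _ hη)

/-- The projection along `v` with kernel direction dual to `l`. -/
def projAlong (l v : Fin n → ℂ) : (Fin n → ℂ) →ₗ[ℂ] (Fin n → ℂ) :=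
  LinearMap.id - (dotProductEquiv ℂ (Fin n) l).smulRight v

theorem projAlong_apply (l v u : Fin n → ℂ) : projAlong l v u = u - (u ⬝ᵥ l) • v := by
  rw [dotProduct_comm]
  rfl

/-- The map is a rank one perturbation of the identity, and since `v ∧ v = 0` only the terms of
order at most one in `v` survive on a wedge product. No relation between `l` and `v` is needed. -/
theorem map_projAlong (l v : Fin n → ℂ) (ω : ExteriorAlgebra ℂ (Fin n → ℂ)) :
    ExteriorAlgebra.map (projAlong l v) ω = ω - ExteriorAlgebra.ι ℂ v * contraction l ω := by
  -- With `F η = η - v ∧ contraction l η`, the claim is that `F (ω * η)` equals the image of `ω`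
  -- times `F η`; in this form it passes to products of `ω`.
  suffices H : ∀ η, ExteriorAlgebra.map (projAlong l v) ω *
      (η - ExteriorAlgebra.ι ℂ v * contraction l η) =
        ω * η - ExteriorAlgebra.ι ℂ v * contraction l (ω * η) by
    have := H 1
    rwa [contraction_one, mul_zero, sub_zero, mul_one, mul_one] at this
  induction ω using ExteriorAlgebra.induction with
  | algebraMap r =>
    intro η
    rw [AlgHom.commutes, ← Algebra.smul_def, ← Algebra.smul_def, map_smul, mul_smul_comm, smul_sub]
  | ι u =>
    intro η
    have h2 : ExteriorAlgebra.ι ℂ u * (ExteriorAlgebra.ι ℂ v * contraction l η) =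
        -(ExteriorAlgebra.ι ℂ v * (ExteriorAlgebra.ι ℂ u * contraction l η)) := by
      rw [← mul_assoc, ι_mul_ι, neg_mul, mul_assoc]
    have h3 : ExteriorAlgebra.ι ℂ v * (ExteriorAlgebra.ι ℂ v * contraction l η) = 0 := by
      rw [← mul_assoc, ExteriorAlgebra.ι_sq_zero, zero_mul]
    rw [ExteriorAlgebra.map_apply_ι, projAlong_apply, contraction_ι_mul, map_sub, map_smul,
      sub_mul, mul_sub, mul_sub, mul_sub, smul_mul_assoc, smul_mul_assoc, h2, h3, mul_smul_comm]
    simp only [smul_zero, sub_zero]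
    abel
  | mul x y hx hy =>
    intro η
    rw [map_mul, mul_assoc, hy, hx, mul_assoc]
  | add x y hx hy =>
    intro η
    rw [map_add, add_mul, hx, hy, add_mul, map_add, mul_add]
    abel

/-- An element of the exterior algebra killed by all contractions along the common zero set of some
linear forms is a combination of wedge products of these forms. -/
theorem mem_wedgeSpan_of_contraction_eq_zero {a : ι → Fin n → ℂ} {K : Finset ι}
    {ω : ExteriorAlgebra ℂ (Fin n → ℂ)}
    (hω : ∀ l ∈ flat a (K : Set ι), contraction l ω = 0) : ω ∈ wedgeSpan a K := by
  -- Induction on the rank of an endomorphism `p` fixing `ω`, starting from the identity. While the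
  -- range of `p` contains some `v` outside the span of `K`, composing with a projection that kills
  -- `v` still fixes `ω`, because `ω` is killed by the contraction involved, and it lowers the rank.
  suffices H : ∀ (d : ℕ) (p : (Fin n → ℂ) →ₗ[ℂ] (Fin n → ℂ)),
      Module.finrank ℂ (LinearMap.range p) = d → ExteriorAlgebra.map p ω = ω →
        ω ∈ wedgeSpan a K from
    H _ LinearMap.id rfl (by simp)
  intro d
  induction d using Nat.strong_induction_on with
  | _ d ih =>
    intro p hd hp
    by_cases hr : LinearMap.range p ≤ Submodule.span ℂ (a '' (K : Set ι))
    · rw [← hp]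
      exact map_mem_wedgeSpan hr ω
    obtain ⟨v, hv, hvK⟩ := SetLike.not_le_iff_exists.1 hr
    obtain ⟨l, hl, hvl⟩ := exists_mem_flat hvK
    have hmap : ExteriorAlgebra.map (projAlong l v ∘ₗ p) ω = ω := by
      rw [← ExteriorAlgebra.map_comp_map, AlgHom.comp_apply, hp, map_projAlong, hω l hl,
        mul_zero, sub_zero]
    refine ih _ ?_ _ rfl hmap
    rw [← hd]
    refine Submodule.finrank_lt_finrank_of_lt (lt_of_le_of_ne ?_ ?_)
    · rintro _ ⟨u, rfl⟩
      rw [LinearMap.comp_apply, projAlong_apply]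
      exact sub_mem ⟨u, rfl⟩ (Submodule.smul_mem _ _ hv)
    · intro heq
      rw [← heq] at hv
      obtain ⟨u, hu⟩ := hv
      have h := congrArg (· ⬝ᵥ l) hu
      simp only [LinearMap.comp_apply, projAlong_apply, sub_dotProduct, smul_dotProduct, hvl,
        smul_eq_mul, mul_one, sub_self] at h
      exact zero_ne_one h

end Exterior

/-! ### Degree bounds, passive elements, and the induction by deletion and contraction. -/

section Core

variable {n : ℕ} {ι : Type*}

/-- The number of elements of `A` whose linear form does not vanish at `l`. -/
def rhoOn (a : ι → Fin n → ℂ) (A : Finset ι) (l : Fin n → ℂ) : ℕ :=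
  (A.filter fun i => a i ⬝ᵥ l ≠ 0).card

/-- The elements of superspace whose degree along each `l` in `W` is at most `r l`, up to elements
vanishing on `W`. -/
def degreeBounded (W : Submodule ℂ (Fin n → ℂ)) (r : (Fin n → ℂ) → ℕ) : Submodule ℂ (Omega n) where
  carrier := {g | ∀ l ∈ W, (derivX l ^ (r l + 1)) g ∈ vanishing W ∧
    (derivX l ^ r l) (derivTheta l g) ∈ vanishing W}
  zero_mem' l _ := by simp
  add_mem' hg hh l hl := by
    simp only [map_add]
    exact ⟨add_mem (hg l hl).1 (hh l hl).1, add_mem (hg l hl).2 (hh l hl).2⟩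
  smul_mem' c g hg l hl := by
    simp only [map_smul]
    exact ⟨Submodule.smul_mem _ _ (hg l hl).1, Submodule.smul_mem _ _ (hg l hl).2⟩

theorem mem_degreeBounded {W : Submodule ℂ (Fin n → ℂ)} {r : (Fin n → ℂ) → ℕ} {g : Omega n} :
    g ∈ degreeBounded W r ↔ ∀ l ∈ W, (derivX l ^ (r l + 1)) g ∈ vanishing W ∧
      (derivX l ^ r l) (derivTheta l g) ∈ vanishing W := Iff.rfl

theorem vanishing_le_degreeBounded (W : Submodule ℂ (Fin n → ℂ)) (r : (Fin n → ℂ) → ℕ) :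
    vanishing W ≤ degreeBounded W r := fun _ hg l hl =>
  ⟨derivX_pow_mem_vanishing hl hg _, derivX_pow_mem_vanishing hl (derivTheta_mem_vanishing l hg) _⟩

theorem degreeBounded_le {W W' : Submodule ℂ (Fin n → ℂ)} {r r' : (Fin n → ℂ) → ℕ} (hW : W' ≤ W)
    (hr : ∀ l ∈ W', r l = r' l) : degreeBounded W r ≤ degreeBounded W' r' := fun g hg l hl => by
  rw [← hr l hl]
  exact ⟨vanishing_anti hW (hg l (hW hl)).1, vanishing_anti hW (hg l (hW hl)).2⟩

/-- A form nonzero at `l` raises the degree along `l` by exactly one. The proof descends from a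
power of `derivX l` that kills `g`: in `derivX_pow_bos_mul` the higher power is already known to
vanish on `W`, and the other term has a nonzero coefficient. -/
theorem derivX_pow_mem_vanishing_of_linearForm_mul {W : Submodule ℂ (Fin n → ℂ)}
    {l v : Fin n → ℂ} (hl : l ∈ W) (hv : v ⬝ᵥ l ≠ 0) {k : ℕ} {g : Omega n}
    (h : (derivX l ^ (k + 1)) (bos (linearForm v) * g) ∈ vanishing W) :
    (derivX l ^ k) g ∈ vanishing W := by
  have key (j : ℕ) : (derivX l ^ (k + j)) g ∈ vanishing W → (derivX l ^ k) g ∈ vanishing W := by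
    induction j with
    | zero => exact id
    | succ j ih =>
      intro hj
      refine ih ?_
      have h1 := derivX_pow_mem_vanishing hl h j
      rw [← Module.End.mul_apply, ← pow_add, show j + (k + 1) = k + j + 1 by ring,
        derivX_pow_bos_mul] at h1
      have h2 := (Submodule.add_mem_iff_right _ (bos_mul_mem_vanishing _ hj)).1 h1
      exact (Submodule.smul_mem_iff _
        (mul_ne_zero (Nat.cast_ne_zero.2 (Nat.succ_ne_zero _)) hv)).1 h2
  obtain ⟨N, hN⟩ := exists_derivX_pow_eq_zero l g
  refine key N ?_
  rw [pow_add, Module.End.mul_apply, hN, map_zero]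
  exact zero_mem _

/-- The degree of `g` along `l`, counting both kinds of variables, is at most `r`. -/
def DegreeLE (l : Fin n → ℂ) (r : ℕ) (g : Omega n) : Prop :=
  (derivX l ^ (r + 1)) g = 0 ∧ (derivX l ^ r) (derivTheta l g) = 0

theorem DegreeLE.mono {l : Fin n → ℂ} {r r' : ℕ} {g : Omega n} (h : DegreeLE l r g) (hr : r ≤ r') :
    DegreeLE l r' g := by
  obtain ⟨j, rfl⟩ := Nat.exists_eq_add_of_le' hr
  refine ⟨?_, ?_⟩
  · rw [add_assoc, pow_add, Module.End.mul_apply, h.1, map_zero]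
  · rw [pow_add, Module.End.mul_apply, h.2, map_zero]

theorem degreeLE_one (l : Fin n → ℂ) : DegreeLE l 0 (1 : Omega n) := by
  rw [Algebra.TensorProduct.one_def]
  exact ⟨by simp, by simp [contraction_one]⟩

theorem DegreeLE.bos_linearForm_mul {l v : Fin n → ℂ} {r : ℕ} {g : Omega n}
    (h : DegreeLE l r g) :
    DegreeLE l (r + if v ⬝ᵥ l ≠ 0 then 1 else 0) (bos (linearForm v) * g) := by
  unfold DegreeLE
  by_cases hv : v ⬝ᵥ l = 0
  · rw [if_neg (by simpa), add_zero, derivTheta_bos_mul, derivX_pow_bos_mul_of_eq_zero hv,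
      derivX_pow_bos_mul_of_eq_zero hv, h.1, h.2, mul_zero]
    exact ⟨rfl, rfl⟩
  · rw [if_pos hv, derivTheta_bos_mul, derivX_pow_bos_mul, derivX_pow_bos_mul, h.1, h.2,
      (h.mono (Nat.le_succ r)).1, (h.mono (Nat.le_succ r)).2]
    simp

theorem DegreeLE.thetaForm_mul {l v : Fin n → ℂ} {r : ℕ} {g : Omega n}
    (h : DegreeLE l r g) :
    DegreeLE l (r + if v ⬝ᵥ l ≠ 0 then 1 else 0) (thetaForm v * g) := by
  unfold DegreeLE
  by_cases hv : v ⬝ᵥ l = 0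
  · rw [if_neg (by simpa), add_zero, derivTheta_thetaForm_mul, map_sub,
      derivX_pow_thetaForm_mul, derivX_pow_thetaForm_mul, h.1, h.2, hv]
    simp
  · rw [if_pos hv, derivTheta_thetaForm_mul, map_sub, map_smul,
      derivX_pow_thetaForm_mul, derivX_pow_thetaForm_mul, h.1,
      (h.mono (Nat.le_succ r)).1, (h.mono (Nat.le_succ r)).2]
    simp

variable [LinearOrder ι]

theorem rhoOn_insert (a : ι → Fin n → ℂ) {A : Finset ι} {i : ι} (hi : i ∉ A) (l : Fin n → ℂ) :
    rhoOn a (insert i A) l = rhoOn a A l + if a i ⬝ᵥ l ≠ 0 then 1 else 0 := by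
  unfold rhoOn
  rw [Finset.filter_insert]
  split_ifs
  · rw [Finset.card_insert_of_notMem (by simp [hi])]
  · rfl

theorem degreeLE_one_tmul_wedge (a : ι → Fin n → ℂ) (T : Finset ι) (l : Fin n → ℂ) :
    DegreeLE l (rhoOn a T l) (1 ⊗ₜ wedge a (T.sort (· ≤ ·))) := by
  induction T using Finset.induction_on_min with
  | empty => simpa [rhoOn, ← Algebra.TensorProduct.one_def] using degreeLE_one l
  | insert m T hm ih =>
    have hmT : m ∉ T := fun h => lt_irrefl _ (hm m h)
    rw [Finset.sort_insert (· ≤ ·) (fun b hb => (hm b hb).le) hmT, wedge_cons,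
      ← thetaForm_mul_tmul, rhoOn_insert a hmT]
    exact ih.thetaForm_mul

theorem DegreeLE.prod_linearForm_mul {l : Fin n → ℂ} {r : ℕ} {g : Omega n} (h : DegreeLE l r g)
    (a : ι → Fin n → ℂ) (E : Finset ι) :
    DegreeLE l (rhoOn a E l + r) (bos (∏ e ∈ E, linearForm (a e)) * g) := by
  induction E using Finset.induction_on with
  | empty => simpa [rhoOn] using h
  | insert i E hi ih =>
    rw [Finset.prod_insert hi, map_mul, mul_assoc, rhoOn_insert a hi, add_right_comm]
    exact ih.bos_linearForm_mul

open Classical in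
/-- The elements of `A` outside `C` that do not depend on the larger elements of `C`. -/
def passiveSet (a : ι → Fin n → ℂ) (A C : Finset ι) : Finset ι :=
  A.filter fun h => h ∉ C ∧ a h ∉ Submodule.span ℂ (a '' {c | c ∈ C ∧ h < c})

open Classical in
theorem mem_passiveSet {a : ι → Fin n → ℂ} {A C : Finset ι} {h : ι} :
    h ∈ passiveSet a A C ↔
      h ∈ A ∧ h ∉ C ∧ a h ∉ Submodule.span ℂ (a '' {c | c ∈ C ∧ h < c}) := by
  simp [passiveSet]

/-- The product of the forms indexed by `passiveSet a A C` and of the differentials indexed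
by `T`. -/
def passiveElement (a : ι → Fin n → ℂ) (A C T : Finset ι) : Omega n :=
  bos (∏ e ∈ passiveSet a A C, linearForm (a e)) * (1 ⊗ₜ wedge a (T.sort (· ≤ ·)))

open Classical in
/-- The independent sets between `K` and `K ∪ A`. -/
def indepBetween (a : ι → Fin n → ℂ) (K A : Finset ι) : Finset (Finset ι) :=
  (K ∪ A).powerset.filter fun C => K ⊆ C ∧ LinearIndepOn ℂ a (C : Set ι)

theorem mem_indepBetween {a : ι → Fin n → ℂ} {K A C : Finset ι} :
    C ∈ indepBetween a K A ↔ C ⊆ K ∪ A ∧ K ⊆ C ∧ LinearIndepOn ℂ a (C : Set ι) := by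
  classical
  rw [indepBetween, Finset.mem_filter, Finset.mem_powerset]

/-- The span of the elements indexed by the independent sets between `K` and `K ∪ A`. -/
def passiveSpan (a : ι → Fin n → ℂ) (K A : Finset ι) : Submodule ℂ (Omega n) :=
  Submodule.span ℂ {g | ∃ C ∈ indepBetween a K A, ∃ T ⊆ C, passiveElement a A C T = g}

/-- The factors come from the disjoint sets `passiveSet a A C` and `T`. Each one raises the degree
along `l` by at most one, and only if its form is nonzero at `l`; on the flat, the factors from `K`
do not count. -/
theorem passiveSpan_le_degreeBounded (a : ι → Fin n → ℂ) (K A : Finset ι) :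
    passiveSpan a K A ≤ degreeBounded (flat a (K : Set ι)) (rhoOn a A) := by
  refine Submodule.span_le.2 ?_
  rintro _ ⟨C, hC, T, hT, rfl⟩ l hl
  rw [mem_indepBetween] at hC
  have h : DegreeLE l (rhoOn a A l) (passiveElement a A C T) := by
    refine ((degreeLE_one_tmul_wedge a T l).prod_linearForm_mul a _).mono ?_
    unfold rhoOn
    rw [← Finset.card_union_of_disjoint]
    · refine Finset.card_le_card fun i hi => ?_
      rw [Finset.mem_union, Finset.mem_filter, Finset.mem_filter, mem_passiveSet] at hi
      rw [Finset.mem_filter]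
      rcases hi with hi | hi
      · exact ⟨hi.1.1, hi.2⟩
      · refine ⟨(Finset.mem_union.1 (hC.1 (hT hi.1))).resolve_left fun hK => ?_, hi.2⟩
        exact hi.2 (mem_flat.1 hl i hK)
    · rw [Finset.disjoint_left]
      intro i hi hi'
      rw [Finset.mem_filter, mem_passiveSet] at hi
      exact hi.1.2.1 (hT (Finset.mem_filter.1 hi').1)
  rw [h.1, h.2]
  exact ⟨zero_mem _, zero_mem _⟩

/-- Division by the form of `m` passes to the deletion. Where it is nonzero at `l`, it accounts for
one degree; where it is zero, it commutes with `derivX l` and cancels, because it does not vanish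
identically on the flat. -/
theorem mem_degreeBounded_of_linearForm_mul {a : ι → Fin n → ℂ} {K A : Finset ι} {m : ι}
    (hm : m ∉ A) (hmK : a m ∉ Submodule.span ℂ (a '' (K : Set ι))) {g : Omega n}
    (hg : bos (linearForm (a m)) * g ∈
      degreeBounded (flat a (K : Set ι)) (rhoOn a (insert m A))) :
    g ∈ degreeBounded (flat a (K : Set ι)) (rhoOn a A) := by
  intro l hl
  obtain ⟨w, hw, hmw⟩ := exists_mem_flat hmK
  have hmw' : a m ⬝ᵥ w ≠ 0 := by rw [hmw]; exact one_ne_zero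
  obtain ⟨h1, h2⟩ := hg l hl
  rw [derivTheta_bos_mul] at h2
  rw [rhoOn_insert a hm] at h1 h2
  by_cases h : a m ⬝ᵥ l = 0
  · rw [if_neg (by simpa), add_zero, derivX_pow_bos_mul_of_eq_zero h] at h1 h2
    exact ⟨mem_vanishing_of_linearForm_mul_mem hw hmw' h1,
      mem_vanishing_of_linearForm_mul_mem hw hmw' h2⟩
  · rw [if_pos h] at h1 h2
    exact ⟨derivX_pow_mem_vanishing_of_linearForm_mul hl h h1,
      derivX_pow_mem_vanishing_of_linearForm_mul hl h h2⟩

/-! ### Effect of the largest element `m` on passive sets, independent sets and flats. -/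

section Step

variable {a : ι → Fin n → ℂ} {K A : Finset ι} {m : ι}

theorem passiveSet_insert_of_mem {C : Finset ι} (hm : m ∈ C) :
    passiveSet a (insert m A) C = passiveSet a A C := by
  ext h
  rw [mem_passiveSet, mem_passiveSet, Finset.mem_insert]
  constructor
  · rintro ⟨rfl | h1, h2⟩
    · exact absurd hm h2.1
    · exact ⟨h1, h2⟩
  · exact fun h => ⟨Or.inr h.1, h.2⟩

theorem passiveSet_insert_of_mem_span {C : Finset ι} (hKm : ∀ k ∈ K, m < k) (hKC : K ⊆ C)
    (hm : a m ∈ Submodule.span ℂ (a '' (K : Set ι))) :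
    passiveSet a (insert m A) C = passiveSet a A C := by
  ext h
  rw [mem_passiveSet, mem_passiveSet, Finset.mem_insert]
  constructor
  · rintro ⟨rfl | h1, h2⟩
    · refine absurd (Submodule.span_mono (Set.image_mono ?_) hm) h2.2
      exact fun k hk => ⟨hKC hk, hKm k hk⟩
    · exact ⟨h1, h2⟩
  · exact fun h => ⟨Or.inr h.1, h.2⟩

/-- As `m` exceeds every element of `A`, the elements of `C` larger than `m` lie in `K`, and these
do not span `a m`. -/
theorem passiveSet_insert_of_notMem_span {C : Finset ι} (hAm : ∀ i ∈ A, i < m) (hmC : m ∉ C)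
    (hC : C ⊆ K ∪ A) (hm : a m ∉ Submodule.span ℂ (a '' (K : Set ι))) :
    passiveSet a (insert m A) C = insert m (passiveSet a A C) := by
  ext h
  rw [Finset.mem_insert, mem_passiveSet, mem_passiveSet, Finset.mem_insert]
  constructor
  · rintro ⟨rfl | h1, h2⟩
    · exact Or.inl rfl
    · exact Or.inr ⟨h1, h2⟩
  · rintro (rfl | h)
    · refine ⟨Or.inl rfl, hmC, fun h' => hm (Submodule.span_mono (Set.image_mono ?_) h')⟩
      rintro c ⟨hcC, hc⟩
      exact (Finset.mem_union.1 (hC hcC)).resolve_right fun hcA => lt_asymm hc (hAm c hcA)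
    · exact ⟨Or.inr h.1, h.2⟩

theorem passiveElement_insert_of_notMem_span {C T : Finset ι} (hAm : ∀ i ∈ A, i < m) (hmC : m ∉ C)
    (hC : C ⊆ K ∪ A) (hm : a m ∉ Submodule.span ℂ (a '' (K : Set ι))) :
    passiveElement a (insert m A) C T = bos (linearForm (a m)) * passiveElement a A C T := by
  have : m ∉ passiveSet a A C := fun h => lt_irrefl m (hAm m (mem_passiveSet.1 h).1)
  rw [passiveElement, passiveSet_insert_of_notMem_span hAm hmC hC hm, Finset.prod_insert this,
    map_mul, mul_assoc, passiveElement]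

theorem indepBetween_insert_of_mem_span (hmK : m ∉ K)
    (hm : a m ∈ Submodule.span ℂ (a '' (K : Set ι))) :
    indepBetween a K (insert m A) = indepBetween a K A := by
  ext C
  rw [mem_indepBetween, mem_indepBetween, Finset.union_insert]
  constructor
  · rintro ⟨h1, h2, h3⟩
    refine ⟨(Finset.subset_insert_iff_of_notMem fun hmC => ?_).1 h1, h2, h3⟩
    have h4 : LinearIndepOn ℂ a (insert m (K : Set ι)) :=
      h3.mono (Set.insert_subset (by exact_mod_cast hmC) (by exact_mod_cast h2))
    exact ((linearIndepOn_insert (by simpa)).1 h4).2 hm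
  · exact fun h => ⟨h.1.trans (Finset.subset_insert _ _), h.2⟩

/-- Independent sets avoiding `m` belong to the deletion, those containing `m` to the contraction.
-/
theorem indepBetween_insert (hmA : m ∉ A) (hmK : m ∉ K) :
    indepBetween a K (insert m A) = indepBetween a K A ∪ indepBetween a (insert m K) A := by
  ext C
  rw [Finset.mem_union, mem_indepBetween, mem_indepBetween, mem_indepBetween, Finset.union_insert,
    Finset.insert_union, Finset.insert_subset_iff]
  by_cases hmC : m ∈ C
  · have : ¬ C ⊆ K ∪ A := fun h => by
      rcases Finset.mem_union.1 (h hmC) with h | h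
      exacts [hmK h, hmA h]
    tauto
  · rw [Finset.subset_insert_iff_of_notMem hmC]
    tauto

theorem notMem_of_mem_indepBetween (hmA : m ∉ A) (hmK : m ∉ K) {C : Finset ι}
    (hC : C ∈ indepBetween a K A) : m ∉ C := fun h => by
  rcases Finset.mem_union.1 ((mem_indepBetween.1 hC).1 h) with h | h
  exacts [hmK h, hmA h]

theorem flat_insert_le : flat a ((insert m K : Finset ι) : Set ι) ≤ flat a (K : Set ι) :=
  fun _ hl => mem_flat.2 fun k hk => mem_flat.1 hl k (by simp [Finset.mem_coe.1 hk])

theorem mem_flat_insert {w : Fin n → ℂ} (hw : w ∈ flat a (K : Set ι)) (hm : a m ⬝ᵥ w = 0) :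
    w ∈ flat a ((insert m K : Finset ι) : Set ι) := by
  refine mem_flat.2 fun k hk => ?_
  rcases Finset.mem_insert.1 hk with rfl | hk
  exacts [hm, mem_flat.1 hw k hk]

theorem dotProduct_eq_zero_of_mem_flat_insert {w : Fin n → ℂ}
    (hw : w ∈ flat a ((insert m K : Finset ι) : Set ι)) : a m ⬝ᵥ w = 0 :=
  mem_flat.1 hw m (by simp)

end Step

/-- Modulo the elements vanishing on the flat of `K`, the elements indexed by the independent sets
between `K` and `K ∪ A` span the elements of bounded degree. -/
theorem degreeBounded_le_passiveSpan_sup (a : ι → Fin n → ℂ) (K A : Finset ι)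
    (hKA : ∀ i ∈ A, ∀ k ∈ K, i < k) (hK : LinearIndepOn ℂ a (K : Set ι)) :
    degreeBounded (flat a (K : Set ι)) (rhoOn a A) ≤
      passiveSpan a K A ⊔ vanishing (flat a (K : Set ι)) := by
  induction A using Finset.induction_on_max generalizing K with
  | empty =>
    intro g hg
    have hg' := mem_degreeBounded.1 hg
    simp only [rhoOn, Finset.filter_empty, Finset.card_empty, zero_add, pow_one, pow_zero,
      Module.End.one_apply] at hg'
    -- With no forms left the degree bound is zero: `g` is constant along the flat, with constant
    -- value killed by all contractions along it.
    have h1 : evalAt 0 g ∈ wedgeSpan a K := by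
      refine mem_wedgeSpan_of_contraction_eq_zero fun l hl => ?_
      rw [← evalAt_derivTheta]
      exact mem_vanishing.1 (hg' l hl).2 0 (zero_mem _)
    have h2 : (1 ⊗ₜ evalAt 0 g : Omega n) ∈ passiveSpan a K ∅ := by
      refine Submodule.span_induction
        (p := fun ω _ => (1 ⊗ₜ ω : Omega n) ∈ passiveSpan a K ∅) ?_ ?_ ?_ ?_ h1
      · rintro _ ⟨T, hT, rfl⟩
        refine Submodule.subset_span ⟨K, mem_indepBetween.2 ⟨by simp, subset_rfl, hK⟩, T, hT, ?_⟩
        simp [passiveElement, passiveSet]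
      · simp
      · intro x y _ _ hx hy
        rw [TensorProduct.tmul_add]
        exact add_mem hx hy
      · intro c x _ hx
        rw [TensorProduct.tmul_smul]
        exact Submodule.smul_mem _ _ hx
    rw [← add_sub_cancel (1 ⊗ₜ evalAt 0 g) g]
    exact Submodule.add_mem_sup h2 (sub_one_tmul_evalAt_mem_vanishing fun l hl => (hg' l hl).1)
  | insert m A hAm ih =>
    have hmA : m ∉ A := fun h => lt_irrefl _ (hAm m h)
    have hKm : ∀ k ∈ K, m < k := hKA m (Finset.mem_insert_self _ _)
    have hmK : m ∉ K := fun h => lt_irrefl _ (hKm m h)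
    have hKA' : ∀ i ∈ A, ∀ k ∈ K, i < k := fun i hi => hKA i (Finset.mem_insert_of_mem hi)
    -- If `a m` is in the span of `K`, then `m` is a loop after contraction: it changes neither the
    -- degree bound on the flat, nor the independent sets, nor the products.
    by_cases hm : a m ∈ Submodule.span ℂ (a '' (K : Set ι))
    · refine le_trans (degreeBounded_le le_rfl fun l hl => ?_) ((ih K hKA' hK).trans
        (sup_le_sup_right (Submodule.span_mono ?_) _))
      · rw [rhoOn_insert a hmA, if_neg (by simp [dotProduct_eq_zero_of_mem_span hl hm]), add_zero]
      · rintro _ ⟨C, hC, T, hT, rfl⟩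
        refine ⟨C, by rwa [indepBetween_insert_of_mem_span hmK hm], T, hT, ?_⟩
        rw [passiveElement, passiveSet_insert_of_mem_span hKm (mem_indepBetween.1 hC).2.1 hm,
          passiveElement]
    · intro g hg
      have hK' : LinearIndepOn ℂ a ((insert m K : Finset ι) : Set ι) := by
        rw [Finset.coe_insert, linearIndepOn_insert (by simpa)]
        exact ⟨hK, hm⟩
      have hKA'' : ∀ i ∈ A, ∀ k ∈ insert m K, i < k := fun i hi k hk => by
        rcases Finset.mem_insert.1 hk with rfl | hk
        exacts [hAm i hi, hKA' i hi k hk]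
      -- Contraction: the form of `m` vanishes on the smaller flat, so the bound for `A` alone holds
      -- there.
      have hg1 : g ∈ degreeBounded (flat a ((insert m K : Finset ι) : Set ι)) (rhoOn a A) := by
        refine degreeBounded_le flat_insert_le (fun l hl => ?_) hg
        rw [rhoOn_insert a hmA, if_neg (by simp [dotProduct_eq_zero_of_mem_flat_insert hl]),
          add_zero]
      obtain ⟨s, hs, v, hv, rfl⟩ := Submodule.mem_sup.1 (ih _ hKA'' hK' hg1)
      have hs' : s ∈ passiveSpan a K (insert m A) := by
        refine Submodule.span_mono ?_ hs
        rintro _ ⟨C, hC, T, hT, rfl⟩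
        refine ⟨C, ?_, T, hT, ?_⟩
        · rw [indepBetween_insert hmA hmK]
          exact Finset.mem_union_right _ hC
        · rw [passiveElement, passiveSet_insert_of_mem
            ((mem_indepBetween.1 hC).2.1 (Finset.mem_insert_self _ _)), passiveElement]
      obtain ⟨w, hw, hmw⟩ := exists_mem_flat hm
      -- The remainder `v` vanishes on the hyperplane section, hence is the form of `m` times some
      -- `g'` modulo elements vanishing on the flat of `K`. As `v` is again degree bounded, `g'`
      -- satisfies the bound of the deletion.
      obtain ⟨g', hg'⟩ := exists_sub_linearForm_mul_mem_vanishing hw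
        (by rw [hmw]; exact one_ne_zero) (fun _ => mem_flat_insert) hv
      have hv' : v ∈ degreeBounded (flat a (K : Set ι)) (rhoOn a (insert m A)) :=
        (Submodule.add_mem_iff_right _ (passiveSpan_le_degreeBounded a K _ hs')).1 hg
      have hg2 : g' ∈ degreeBounded (flat a (K : Set ι)) (rhoOn a A) := by
        refine mem_degreeBounded_of_linearForm_mul hmA hm ?_
        have := sub_mem hv' (vanishing_le_degreeBounded _ _ hg')
        rwa [sub_sub_cancel] at this
      obtain ⟨s', hs2, v', hv2, rfl⟩ := Submodule.mem_sup.1 (ih K hKA' hK hg2)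
      have hs3 : bos (linearForm (a m)) * s' ∈ passiveSpan a K (insert m A) := by
        refine Submodule.span_induction (p := fun x _ => bos (linearForm (a m)) * x ∈
          passiveSpan a K (insert m A)) ?_ ?_ ?_ ?_ hs2
        · rintro _ ⟨C, hC, T, hT, rfl⟩
          refine Submodule.subset_span ⟨C, ?_, T, hT, ?_⟩
          · rw [indepBetween_insert hmA hmK]
            exact Finset.mem_union_left _ hC
          · exact passiveElement_insert_of_notMem_span hAm
              (notMem_of_mem_indepBetween hmA hmK hC) (mem_indepBetween.1 hC).1 hm
        · simp
        · intro x y _ _ hx hy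
          rw [mul_add]
          exact add_mem hx hy
        · intro c x _ hx
          rw [mul_smul_comm]
          exact Submodule.smul_mem _ _ hx
      have heq : s + v = (s + bos (linearForm (a m)) * s') +
          (bos (linearForm (a m)) * v' + (v - bos (linearForm (a m)) * (s' + v'))) := by
        rw [mul_add]
        abel
      rw [heq]
      exact Submodule.add_mem_sup (add_mem hs' hs3) (add_mem (bos_mul_mem_vanishing _ hv2) hg')

/-- The elements indexed by the independent sets between `K` and `K ∪ A` are linearly independent
modulo the elements vanishing on the flat of `K`. -/
theorem passiveElement_coeff_eq_zero (a : ι → Fin n → ℂ) (K A : Finset ι)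
    (hKA : ∀ i ∈ A, ∀ k ∈ K, i < k) (hK : LinearIndepOn ℂ a (K : Set ι))
    {c : Finset ι → Finset ι → ℂ}
    (hc : ∑ C ∈ indepBetween a K A, ∑ T ∈ C.powerset, c C T • passiveElement a A C T ∈
      vanishing (flat a (K : Set ι))) :
    ∀ C ∈ indepBetween a K A, ∀ T ⊆ C, c C T = 0 := by
  induction A using Finset.induction_on_max generalizing K with
  | empty =>
    have hidx : indepBetween a K ∅ = {K} := by
      ext C
      rw [mem_indepBetween, Finset.mem_singleton, Finset.union_empty]
      refine ⟨fun h => h.1.antisymm h.2.1, ?_⟩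
      rintro rfl
      exact ⟨subset_rfl, subset_rfl, hK⟩
    rw [hidx, Finset.sum_singleton] at hc
    have h := mem_vanishing.1 hc 0 (zero_mem _)
    rw [map_sum] at h
    intro C hC
    rw [hidx, Finset.mem_singleton] at hC
    subst hC
    refine wedge_coeff_eq_zero hK ?_
    rw [← h]
    refine Finset.sum_congr rfl fun T _ => ?_
    simp [passiveElement, passiveSet]
  | insert m A hAm ih =>
    have hmA : m ∉ A := fun h => lt_irrefl _ (hAm m h)
    have hKm : ∀ k ∈ K, m < k := hKA m (Finset.mem_insert_self _ _)
    have hmK : m ∉ K := fun h => lt_irrefl _ (hKm m h)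
    have hKA' : ∀ i ∈ A, ∀ k ∈ K, i < k := fun i hi => hKA i (Finset.mem_insert_of_mem hi)
    by_cases hm : a m ∈ Submodule.span ℂ (a '' (K : Set ι))
    · rw [indepBetween_insert_of_mem_span hmK hm] at hc ⊢
      refine ih K hKA' hK ?_
      convert hc using 1
      refine Finset.sum_congr rfl fun C hC => Finset.sum_congr rfl fun T _ => ?_
      rw [passiveElement, passiveElement,
        passiveSet_insert_of_mem_span hKm (mem_indepBetween.1 hC).2.1 hm]
    · have hK' : LinearIndepOn ℂ a ((insert m K : Finset ι) : Set ι) := by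
        rw [Finset.coe_insert, linearIndepOn_insert (by simpa)]
        exact ⟨hK, hm⟩
      have hKA'' : ∀ i ∈ A, ∀ k ∈ insert m K, i < k := fun i hi k hk => by
        rcases Finset.mem_insert.1 hk with rfl | hk
        exacts [hAm i hi, hKA' i hi k hk]
      have hdisj : Disjoint (indepBetween a K A) (indepBetween a (insert m K) A) := by
        rw [Finset.disjoint_left]
        exact fun C hC hC' => notMem_of_mem_indepBetween hmA hmK hC
          ((mem_indepBetween.1 hC').2.1 (Finset.mem_insert_self _ _))
      rw [indepBetween_insert hmA hmK, Finset.sum_union hdisj] at hc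
      have h1 : ∑ C ∈ indepBetween a K A, ∑ T ∈ C.powerset,
          c C T • passiveElement a (insert m A) C T = bos (linearForm (a m)) *
            ∑ C ∈ indepBetween a K A, ∑ T ∈ C.powerset, c C T • passiveElement a A C T := by
        rw [Finset.mul_sum]
        refine Finset.sum_congr rfl fun C hC => ?_
        rw [Finset.mul_sum]
        refine Finset.sum_congr rfl fun T _ => ?_
        rw [mul_smul_comm, passiveElement_insert_of_notMem_span hAm
          (notMem_of_mem_indepBetween hmA hmK hC) (mem_indepBetween.1 hC).1 hm]
      have h2 : ∑ C ∈ indepBetween a (insert m K) A, ∑ T ∈ C.powerset,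
          c C T • passiveElement a (insert m A) C T =
            ∑ C ∈ indepBetween a (insert m K) A, ∑ T ∈ C.powerset,
              c C T • passiveElement a A C T := by
        refine Finset.sum_congr rfl fun C hC => Finset.sum_congr rfl fun T _ => ?_
        rw [passiveElement, passiveSet_insert_of_mem
            ((mem_indepBetween.1 hC).2.1 (Finset.mem_insert_self _ _)), passiveElement]
      rw [h1, h2] at hc
      -- On the smaller flat the terms without `m` disappear, having the form of `m` as a factor, so
      -- the contraction kills the coefficients of the sets containing `m`. The form then cancels
      -- from what remains.
      have h3 : ∀ C ∈ indepBetween a (insert m K) A, ∀ T ⊆ C, c C T = 0 := by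
        refine ih _ hKA'' hK' ?_
        refine (Submodule.add_mem_iff_right _ ?_).1 (vanishing_anti flat_insert_le hc)
        refine mem_vanishing.2 fun w hw => ?_
        rw [evalAt_bos_mul, eval_linearForm, dotProduct_eq_zero_of_mem_flat_insert hw, zero_smul]
      rw [Finset.sum_eq_zero (s := indepBetween a (insert m K) A) fun C hC =>
        Finset.sum_eq_zero fun T hT => by
          rw [h3 C hC T (Finset.mem_powerset.1 hT), zero_smul], add_zero] at hc
      obtain ⟨w, hw, hmw⟩ := exists_mem_flat hm
      have h4 := ih K hKA' hK
        (mem_vanishing_of_linearForm_mul_mem hw (by rw [hmw]; exact one_ne_zero) hc)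
      intro C hC
      rw [indepBetween_insert hmA hmK] at hC
      rcases Finset.mem_union.1 hC with hC | hC
      exacts [h4 C hC, h3 C hC]

end Core

/-! ### The inverse system as a space of bounded degree. -/

section InverseSystem

variable {n : ℕ} {ι : Type*}

/-- Passing an odd variable across `g` only changes signs of its odd part. This lets generators of
the two-sided ideal be moved to the right, where they act first. -/
theorem exists_thetaForm_mul_eq (v : Fin n → ℂ) (g : Omega n) :
    ∃ g', thetaForm v * g = g' * thetaForm v := by
  have hext (ω : ExteriorAlgebra ℂ (Fin n → ℂ)) :
      ∃ η, ExteriorAlgebra.ι ℂ v * ω = η * ExteriorAlgebra.ι ℂ v := by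
    induction ω using ExteriorAlgebra.induction with
    | algebraMap r => exact ⟨algebraMap _ _ r, (Algebra.commutes _ _).symm⟩
    | ι u => exact ⟨-ExteriorAlgebra.ι ℂ u, by rw [ι_mul_ι, neg_mul]⟩
    | mul x y hx hy =>
      obtain ⟨x', hx⟩ := hx
      obtain ⟨y', hy⟩ := hy
      exact ⟨x' * y', by rw [← mul_assoc, hx, mul_assoc, hy, mul_assoc]⟩
    | add x y hx hy =>
      obtain ⟨x', hx⟩ := hx
      obtain ⟨y', hy⟩ := hy
      exact ⟨x' + y', by rw [mul_add, hx, hy, add_mul]⟩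
  induction g using TensorProduct.induction_on with
  | zero => exact ⟨0, by simp⟩
  | tmul q ω =>
    obtain ⟨η, hη⟩ := hext ω
    exact ⟨q ⊗ₜ η, by rw [thetaForm_mul_tmul, hη]; simp [thetaForm]⟩
  | add x y hx hy =>
    obtain ⟨x', hx⟩ := hx
    obtain ⟨y', hy⟩ := hy
    exact ⟨x' + y', by rw [mul_add, hx, hy, add_mul]⟩

theorem diffOp_bos_pow (l : Fin n → ℂ) (k : ℕ) :
    diffOp (bos (linearForm l ^ k)) = derivX l ^ k := by
  rw [map_pow, map_pow, diffOp_bos_linearForm]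

theorem diffOp_totalD_pow (l : Fin n → ℂ) (k : ℕ) :
    diffOp (totalD (bos (linearForm l ^ (k + 1)))) =
      ((k + 1 : ℕ) : ℂ) • (derivX l ^ k * derivTheta l) := by
  rw [totalD_linearForm_pow, map_smul, map_mul, map_pow, diffOp_bos_linearForm, diffOp_thetaForm]

theorem rho_span_singleton [Fintype ι] (a : ι → Fin n → ℂ) (l : Fin n → ℂ) :
    rho a (Submodule.span ℂ {l}) = rhoOn a Finset.univ l := by
  classical
  rw [rho, rhoOn, Nat.card_eq_fintype_card, Fintype.card_subtype]
  congr 1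
  ext i
  simp [Submodule.span_singleton_le_iff_mem, mem_hyperplane]

/-- If `f` can be moved to the right past every element, and `∂f` kills `g`, then so does the operator
of every element of the ideal generated by such `f`. -/
theorem mem_inverseSystem_span {s : Set (Omega n)} {g : Omega n}
    (hs : ∀ f ∈ s, ∀ h, ∃ h', f * h = h' * f) (hg : ∀ f ∈ s, diffOp f g = 0) :
    g ∈ inverseSystem (TwoSidedIdeal.span s) := by
  intro f hf
  -- Allowing factors on both sides makes the annihilation condition two-sided, so it need only be
  -- checked on generators.
  let J : TwoSidedIdeal (Omega n) := TwoSidedIdeal.mk'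
    {f | ∀ h h', diffOp (h * f * h') g = 0}
    (by simp)
    (fun {x y} hx hy h h' => by
      rw [mul_add, add_mul, map_add, LinearMap.add_apply, hx, hy, add_zero])
    (fun {x} hx h h' => by
      have : h * -x * h' = -(h * x * h') := (congrArg (· * h') (mul_neg h x)).trans (neg_mul _ _)
      rw [this, map_neg, LinearMap.neg_apply, hx, neg_zero])
    (fun {x y} hy h h' => by rw [← mul_assoc]; exact hy _ _)
    (fun {x y} hx h h' => by rw [← mul_assoc, mul_assoc]; exact hx _ _)
  have hJ : f ∈ J := by
    refine TwoSidedIdeal.mem_span_iff.1 hf J fun f hf => ?_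
    refine (TwoSidedIdeal.mem_mk' _ _ _ _ _ _ _).2 fun h h' => ?_
    obtain ⟨h'', hh⟩ := hs f hf h'
    rw [mul_assoc, hh, ← mul_assoc, map_mul, Module.End.mul_apply, hg f hf, map_zero]
  have := (TwoSidedIdeal.mem_mk' _ _ _ _ _ _ _).1 hJ 1 1
  rwa [one_mul, mul_one] at this

/-- The inverse system of the superpower ideal consists of the elements of bounded degree along every
line. -/
theorem inverseSystem_superpowerIdeal [Fintype ι] (a : ι → Fin n → ℂ) :
    inverseSystem (superpowerIdeal a) = degreeBounded ⊤ (rhoOn a Finset.univ) := by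
  ext g
  rw [mem_degreeBounded]
  simp only [vanishing_top, Submodule.mem_bot]
  constructor
  · intro hg l _
    -- The zero vector spans no line and gives no generator. Its bound is `0`, so the second
    -- condition reads `derivTheta 0 g = 0` and holds because `derivTheta 0` is zero.
    by_cases hl : l = 0
    · subst hl
      have h0 : derivTheta (0 : Fin n → ℂ) = 0 := by simp [derivTheta]
      have h1 : derivX (0 : Fin n → ℂ) = 0 := by
        rw [← diffOp_bos_linearForm]
        simp [linearForm]
      simp [h0, h1]
    · have h1 := hg _ (TwoSidedIdeal.subset_span ⟨l, hl, Or.inl rfl⟩)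
      have h2 := hg _ (TwoSidedIdeal.subset_span ⟨l, hl, Or.inr rfl⟩)
      rw [odot, diffOp_bos_pow, rho_span_singleton] at h1
      rw [odot, diffOp_totalD_pow, rho_span_singleton, LinearMap.smul_apply, smul_eq_zero,
        Module.End.mul_apply] at h2
      exact ⟨h1, h2.resolve_left (Nat.cast_ne_zero.2 (Nat.succ_ne_zero _))⟩
  · intro hg
    refine mem_inverseSystem_span ?_ ?_
    · rintro f ⟨l, -, rfl | rfl⟩ h
      · exact ⟨h, commute_bos _ _⟩
      · rw [totalD_linearForm_pow]
        obtain ⟨h', hh⟩ := exists_thetaForm_mul_eq l h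
        refine ⟨h', ?_⟩
        rw [smul_mul_assoc, mul_assoc, hh, mul_smul_comm, ← mul_assoc, ← map_pow,
          (commute_bos _ h').eq, mul_assoc]
    · rintro f ⟨l, -, rfl | rfl⟩
      · rw [diffOp_bos_pow, rho_span_singleton]
        exact (hg l trivial).1
      · rw [diffOp_totalD_pow, rho_span_singleton, LinearMap.smul_apply, Module.End.mul_apply,
          (hg l trivial).2, smul_zero]

theorem prodDForm_eq [LinearOrder ι] (a : ι → Fin n → ℂ) (I : Finset ι) :
    prodDForm a I = 1 ⊗ₜ wedge a (I.sort (· ≤ ·)) := by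
  rw [prodDForm]
  induction I.sort (· ≤ ·) with
  | nil => simp [Algebra.TensorProduct.one_def]
  | cons i L ih =>
    rw [List.map_cons, List.prod_cons, ih, wedge_cons, totalD_linearForm, thetaForm_mul_tmul]

theorem flat_empty (a : ι → Fin n → ℂ) : flat a ∅ = ⊤ := by simp [flat]

variable [Fintype ι] [LinearOrder ι]

/-- For `K = ∅` the flat is the whole space, and only zero vanishes there. -/
theorem passiveSpan_eq_inverseSystem (a : ι → Fin n → ℂ) :
    passiveSpan a ∅ Finset.univ = inverseSystem (superpowerIdeal a) := by
  rw [inverseSystem_superpowerIdeal, ← flat_empty a, ← Finset.coe_empty]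
  refine (passiveSpan_le_degreeBounded a ∅ Finset.univ).antisymm ?_
  refine (degreeBounded_le_passiveSpan_sup a ∅ Finset.univ (by simp) (by simp)).trans ?_
  rw [Finset.coe_empty, flat_empty, vanishing_top, sup_bot_eq]

theorem linearIndepOn_passiveElement (a : ι → Fin n → ℂ) :
    LinearIndepOn ℂ (fun p : Σ _ : Finset ι, Finset ι => passiveElement a Finset.univ p.1 p.2)
      ((indepBetween a ∅ Finset.univ).sigma fun C => C.powerset : Finset _) := by
  rw [linearIndepOn_finset_iff]
  intro c hc p hp
  rw [Finset.sum_sigma] at hc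
  rw [Finset.mem_sigma, Finset.mem_powerset] at hp
  refine passiveElement_coeff_eq_zero a ∅ Finset.univ (by simp) (by simp)
    (c := fun C T => c ⟨C, T⟩) ?_ p.1 hp.1 p.2 hp.2
  rw [hc]
  exact zero_mem _

end InverseSystem

/-! ### Activities of bases and the bijection with independent sets. -/

section Bases

variable {n : ℕ} {ι : Type*} {a : ι → Fin n → ℂ}

/-- Coordinates in an independent family are unique: if `x` is also in the span of `B` without `b`,
its coordinate at `b` is zero, so `b` can be dropped. -/
theorem mem_span_diff_of_linearIndepOn {B E F : Set ι} (hB : LinearIndepOn ℂ a B) (hE : E ⊆ B)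
    {x : Fin n → ℂ} (hx : x ∈ Submodule.span ℂ (a '' E))
    (hF : ∀ b ∈ F, b ∈ E → x ∈ Submodule.span ℂ (a '' (B \ {b}))) :
    x ∈ Submodule.span ℂ (a '' (E \ F)) := by
  rw [Finsupp.mem_span_image_iff_linearCombination] at hx ⊢
  obtain ⟨f, hf, rfl⟩ := hx
  refine ⟨f, fun b hb => ⟨hf hb, fun hbF => ?_⟩, rfl⟩
  obtain ⟨f', hf', h⟩ := (Finsupp.mem_span_image_iff_linearCombination ℂ).1 (hF b hbF (hf hb))
  have : f' - f = 0 := linearIndepOn_iff.1 hB _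
    (sub_mem (Finsupp.supported_mono Set.sdiff_subset hf') (Finsupp.supported_mono hE hf))
    (by rw [map_sub, h, sub_self])
  rw [sub_eq_zero] at this
  subst this
  exact (hf' hb).2 rfl

theorem IsBasis.mem_span {B : Finset ι} (hB : IsBasis a B) (i : ι) :
    a i ∈ Submodule.span ℂ (a '' (B : Set ι)) := by
  rw [hB.2]
  exact Submodule.subset_span ⟨i, rfl⟩

theorem isBasis_of_mem_span {B : Finset ι} (hB : LinearIndepOn ℂ a (B : Set ι))
    (h : ∀ i, a i ∈ Submodule.span ℂ (a '' (B : Set ι))) : IsBasis a B := by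
  refine ⟨hB, (Submodule.span_mono (Set.image_subset_range _ _)).antisymm (Submodule.span_le.2 ?_)⟩
  rintro _ ⟨i, rfl⟩
  exact h i

variable [LinearOrder ι]

theorem IsBasis.eq_of_subset {B B' : Finset ι} (hB : IsBasis a B) (hB' : IsBasis a B')
    (h : B ⊆ B') : B = B' := by
  refine h.antisymm fun i hi => ?_
  by_contra hiB
  refine hB'.1.notMem_span (Finset.mem_coe.2 hi) (Submodule.span_mono (Set.image_mono ?_)
    (hB.mem_span i))
  exact fun j hj => ⟨h hj, by rintro rfl; exact hiB hj⟩

theorem IsBasis.exchange {B : Finset ι} (hB : IsBasis a B) {b h : ι} (hb : b ∈ B) (hh : h ∉ B)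
    (hs : a h ∉ Submodule.span ℂ (a '' ((B : Set ι) \ {b}))) :
    IsBasis a (insert h (B.erase b)) := by
  have hcoe : ((insert h (B.erase b) : Finset ι) : Set ι) = insert h ((B : Set ι) \ {b}) := by
    simp
  have hins : insert b ((B : Set ι) \ {b}) = B := Set.insert_sdiff_self_of_mem (by exact_mod_cast hb)
  have hb' : a b ∈ Submodule.span ℂ (a '' insert h ((B : Set ι) \ {b})) := by
    rw [Set.image_insert_eq]
    refine mem_span_insert_exchange ?_ hs
    rw [← Set.image_insert_eq, hins]
    exact hB.mem_span h
  refine isBasis_of_mem_span ?_ fun i => ?_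
  · rw [hcoe, linearIndepOn_insert fun h' => hh h'.1]
    exact ⟨hB.1.mono Set.sdiff_subset, hs⟩
  · rw [hcoe]
    refine Submodule.span_le.2 ?_ (hB.mem_span i)
    rintro _ ⟨j, hj, rfl⟩
    by_cases hjb : j = b
    · rw [hjb]
      exact hb'
    · exact Submodule.subset_span ⟨j, Or.inr ⟨hj, hjb⟩, rfl⟩

/-- An element of a basis is internally active if and only if all smaller elements depend on the
rest of the basis. -/
theorem internallyActive_iff {B : Finset ι} (hB : IsBasis a B) {h : ι} :
    InternallyActive a B h ↔
      h ∈ B ∧ ∀ j < h, a j ∈ Submodule.span ℂ (a '' ((B : Set ι) \ {h})) := by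
  refine and_congr_right fun hh => ⟨fun hact j hj => ?_, fun hspan B' hB' hsub => ?_⟩
  -- Otherwise exchanging `h` for the smaller `j` would give a lexicographically smaller basis.
  · by_contra hjs
    have hjB : j ∉ B := fun hjB => hjs (Submodule.subset_span ⟨j, ⟨hjB, hj.ne⟩, rfl⟩)
    have hhB' : h ∉ insert j (B.erase h) := by simp [hj.ne']
    rcases hact _ (hB.exchange hh hjB hjs) (Finset.subset_insert _ _) with heq | ⟨i, hi, hi', hlt⟩
    · exact hhB' (heq ▸ hh)
    · have hih : i = h := by
        by_contra hne
        exact hi' (Finset.mem_insert_of_mem (Finset.mem_erase.2 ⟨hne, hi⟩))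
      subst hih
      exact hjB ((hlt j hj).2 (Finset.mem_insert_self _ _))
  · by_cases hhB' : h ∈ B'
    · left
      refine hB.eq_of_subset hB' fun i hi => ?_
      by_cases hih : i = h
      · rwa [hih]
      · exact hsub (Finset.mem_erase.2 ⟨hih, hi⟩)
    · refine Or.inr ⟨h, hh, hhB', fun j hj => ⟨fun hjB => hsub (Finset.mem_erase.2 ⟨hj.ne, hjB⟩),
        fun hjB' => ?_⟩⟩
      by_contra hjB
      refine hB'.1.notMem_span (Finset.mem_coe.2 hjB')
        (Submodule.span_mono (Set.image_mono ?_) (hspan j hj))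
      rintro k ⟨hk, hkh⟩
      exact ⟨hsub (Finset.mem_erase.2 ⟨hkh, hk⟩), by rintro rfl; exact hjB hk⟩

/-- An element outside a basis is externally active if and only if it depends on the larger elements
of the basis. -/
theorem externallyActive_iff {B : Finset ι} (hB : IsBasis a B) {h : ι} :
    ExternallyActive a B h ↔
      h ∉ B ∧ a h ∈ Submodule.span ℂ (a '' {b | b ∈ B ∧ h < b}) := by
  refine and_congr_right fun hh => ⟨fun hact => ?_, fun hspan B' hB' hsub => ?_⟩
  · have hset : (B : Set ι) \ {b | ¬ h < b} = {b | b ∈ B ∧ h < b} := by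
      ext b
      simp
    rw [← hset]
    -- An element `b < h` with nonzero coordinate in `a h` could be exchanged for `h`, giving a
    -- lexicographically larger basis inside `B ∪ {h}`.
    refine mem_span_diff_of_linearIndepOn hB.1 subset_rfl (hB.mem_span h) fun b hb hbB => ?_
    by_contra hs
    have hbh : b < h := lt_of_le_of_ne (not_lt.1 hb) fun heq => hh (heq ▸ hbB)
    rcases hact _ (hB.exchange hbB hh hs)
      (Finset.insert_subset_insert _ (Finset.erase_subset _ _)) with heq | ⟨i, hi, hi', hlt⟩
    · exact hh (heq ▸ Finset.mem_insert_self _ _)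
    · have hih : i = h := (Finset.mem_insert.1 hi).resolve_right fun h' =>
        hi' (Finset.mem_of_mem_erase h')
      subst hih
      have := (hlt b hbh).2 hbB
      simp [hbh.ne] at this
  · by_cases hhB' : h ∈ B'
    · refine Or.inr ⟨h, hhB', hh, fun j hj => ⟨fun hjB' =>
        (Finset.mem_insert.1 (hsub hjB')).resolve_left hj.ne, fun hjB => ?_⟩⟩
      by_contra hjB'
      refine hB.1.notMem_span (Finset.mem_coe.2 hjB) (Submodule.span_le.2 ?_ (hB'.mem_span j))
      rintro _ ⟨k, hk, rfl⟩
      rcases Finset.mem_insert.1 (hsub hk) with rfl | hkB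
      · refine Submodule.span_mono (Set.image_mono ?_) hspan
        exact fun b hb => ⟨hb.1, (hj.trans hb.2).ne'⟩
      · exact Submodule.subset_span ⟨k, ⟨hkB, by rintro rfl; exact hjB' hk⟩, rfl⟩
    · left
      exact hB'.eq_of_subset hB ((Finset.subset_insert_iff_of_notMem hhB').1 hsub)

variable [Fintype ι]

theorem mem_IA {B : Finset ι} (hB : IsBasis a B) {h : ι} :
    h ∈ IA a B ↔ h ∈ B ∧ ∀ j < h, a j ∈ Submodule.span ℂ (a '' ((B : Set ι) \ {h})) := by
  classical
  rw [← internallyActive_iff hB, IA, Finset.mem_filter_univ]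

theorem mem_IP {B : Finset ι} {h : ι} : h ∈ IP a B ↔ h ∈ B ∧ h ∉ IA a B := by
  classical
  rw [IP, IA, Finset.mem_filter_univ, Finset.mem_filter_univ]

theorem mem_EP {B : Finset ι} (hB : IsBasis a B) {h : ι} :
    h ∈ EP a B ↔ h ∉ B ∧ a h ∉ Submodule.span ℂ (a '' {b | b ∈ B ∧ h < b}) := by
  classical
  rw [EP, Finset.mem_filter_univ, externallyActive_iff hB]
  tauto

/-- A set of internally active elements is determined by its complement in the basis. -/
theorem mem_iff_of_subset_IA {B S : Finset ι} (hB : IsBasis a B) (hS : S ⊆ IA a B) {h : ι} :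
    h ∈ S ↔ h ∉ B \ S ∧ a h ∉ Submodule.span ℂ (a '' {j | j ∈ B \ S ∨ j < h}) := by
  constructor
  · intro hh
    obtain ⟨hhB, hact⟩ := (mem_IA hB).1 (hS hh)
    refine ⟨by simp [hh], fun hs => hB.1.notMem_span (Finset.mem_coe.2 hhB)
      (Submodule.span_le.2 ?_ hs)⟩
    rintro _ ⟨j, hj | hj, rfl⟩
    · rw [Finset.mem_sdiff] at hj
      exact Submodule.subset_span ⟨j, ⟨hj.1, by rintro rfl; exact hj.2 hh⟩, rfl⟩
    · exact hact j hj
  · rintro ⟨hC, hs⟩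
    by_contra hhS
    have hhB : h ∉ B := fun hhB => hC (Finset.mem_sdiff.2 ⟨hhB, hhS⟩)
    -- If `b` in `S` is larger than `h`, its activity makes the coordinate of `a h` at `b` zero.
    -- What remains is in `B \ S` or smaller than `h`.
    have key := mem_span_diff_of_linearIndepOn (F := {b | b ∈ S ∧ h < b}) hB.1 subset_rfl
      (hB.mem_span h) fun b hb _ => ((mem_IA hB).1 (hS hb.1)).2 h hb.2
    refine hs (Submodule.span_mono (Set.image_mono ?_) key)
    rintro b ⟨hbB, hb⟩
    by_cases hbS : b ∈ S
    · refine Or.inr (lt_of_le_of_ne (not_lt.1 fun h' => hb ⟨hbS, h'⟩) ?_)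
      rintro rfl
      exact hhB hbB
    · exact Or.inl (Finset.mem_sdiff.2 ⟨hbB, hbS⟩)

/-- Every independent set is obtained from a basis by removing internally active elements. -/
theorem exists_isBasis_sdiff {C : Finset ι} (hC : LinearIndepOn ℂ a (C : Set ι)) :
    ∃ B S : Finset ι, IsBasis a B ∧ S ⊆ IA a B ∧ B \ S = C := by
  classical
  -- These are the elements that the greedy algorithm, running upwards from the smallest index, adds
  -- to complete `C` to a basis.
  let S : Finset ι := {h | h ∉ C ∧ a h ∉ Submodule.span ℂ (a '' {j | j ∈ C ∨ j < h})}
  have hS {h : ι} : h ∈ S ↔ h ∉ C ∧ a h ∉ Submodule.span ℂ (a '' {j | j ∈ C ∨ j < h}) := by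
    simp [S]
  have hind : ∀ S' ⊆ S, LinearIndepOn ℂ a ((C ∪ S' : Finset ι) : Set ι) := by
    intro S'
    induction S' using Finset.induction_on_max with
    | empty => simpa using hC
    | insert m S' hm ih =>
      intro hS'
      obtain ⟨hmC, hms⟩ := hS.1 (hS' (Finset.mem_insert_self _ _))
      have hmS' : m ∉ S' := fun h => lt_irrefl _ (hm m h)
      rw [Finset.union_insert, Finset.coe_insert, linearIndepOn_insert (by simp [hmC, hmS'])]
      refine ⟨ih ((Finset.subset_insert _ _).trans hS'), fun h => hms
        (Submodule.span_mono (Set.image_mono ?_) h)⟩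
      intro j hj
      rcases Finset.mem_union.1 hj with hj | hj
      exacts [Or.inl hj, Or.inr (hm j hj)]
  -- Used twice: with `P` always true it shows that `C ∪ S` spans, and with `P` meaning `< h` that
  -- each `h` in `S` is internally active.
  have hsp (D : Set ι) (P : ι → Prop) (hP : ∀ i j, P i → j < i → P j) (hCD : (C : Set ι) ⊆ D)
      (hSD : ∀ j ∈ S, P j → j ∈ D) : ∀ j, P j → a j ∈ Submodule.span ℂ (a '' D) := by
    intro j
    induction j using WellFoundedLT.induction with
    | ind j ih =>
      intro hj
      by_cases hjC : j ∈ C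
      · exact Submodule.subset_span ⟨j, hCD hjC, rfl⟩
      by_cases hjS : j ∈ S
      · exact Submodule.subset_span ⟨j, hSD j hjS hj, rfl⟩
      have h : a j ∈ Submodule.span ℂ (a '' {i | i ∈ C ∨ i < j}) := by
        by_contra h
        exact hjS (hS.2 ⟨hjC, h⟩)
      refine Submodule.span_le.2 ?_ h
      rintro _ ⟨i, hi | hi, rfl⟩
      exacts [Submodule.subset_span ⟨i, hCD hi, rfl⟩, ih i hi (hP j i hj hi)]
  have hB : IsBasis a (C ∪ S) := isBasis_of_mem_span (hind S subset_rfl) fun i =>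
    hsp _ (fun _ => True) (fun _ _ _ _ => trivial) (by simp)
      (fun j hj _ => by simp [hj]) i trivial
  refine ⟨C ∪ S, S, hB, fun h hh => (mem_IA hB).2 ⟨Finset.mem_union_right _ hh, ?_⟩, ?_⟩
  · refine hsp _ (· < h) (fun i j hi hj => hj.trans hi) (fun j hj => ⟨by simp [Finset.mem_coe.1 hj], ?_⟩)
      fun j hj hjh => ⟨by simp [hj], hjh.ne⟩
    rintro rfl
    exact (hS.1 hh).1 hj
  · refine Finset.union_sdiff_cancel_right (Finset.disjoint_left.2 fun h hhC hhS => ?_)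
    exact (hS.1 hhS).1 hhC

/-- For `h` outside `B`, the coordinates of `a h` at larger elements of `S` vanish by internal
activity, so removing `S` does not change whether `h` is spanned from above. The elements of `S`
themselves become passive once removed. -/
theorem passiveSet_sdiff {B S : Finset ι} (hB : IsBasis a B) (hS : S ⊆ IA a B) :
    passiveSet a Finset.univ (B \ S) = EP a B ∪ S := by
  ext h
  rw [mem_passiveSet, Finset.mem_union, mem_EP hB]
  by_cases hhS : h ∈ S
  · have h2 := ((mem_iff_of_subset_IA hB hS).1 hhS)
    refine iff_of_true ⟨Finset.mem_univ _, h2.1, fun h' => h2.2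
      (Submodule.span_mono (Set.image_mono fun j hj => Or.inl hj.1) h')⟩ (Or.inr hhS)
  by_cases hhB : h ∈ B
  · simp [hhS, hhB]
  have hiff : a h ∈ Submodule.span ℂ (a '' {c | c ∈ B \ S ∧ h < c}) ↔
      a h ∈ Submodule.span ℂ (a '' {b | b ∈ B ∧ h < b}) := by
    constructor
    · refine fun h' => Submodule.span_mono (Set.image_mono ?_) h'
      exact fun c hc => ⟨(Finset.mem_sdiff.1 hc.1).1, hc.2⟩
    · intro h'
      have := mem_span_diff_of_linearIndepOn (F := (S : Set ι)) hB.1 (fun b hb => hb.1) h'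
        fun b hb hbE => ((mem_IA hB).1 (hS hb)).2 h hbE.2
      refine Submodule.span_mono (Set.image_mono ?_) this
      exact fun c hc => ⟨Finset.mem_sdiff.2 ⟨hc.1.1, hc.2⟩, hc.1.2⟩
  rw [hiff]
  simp [hhS, hhB]

/-- The pair of an independent set and a subset of it attached to an index. -/
def Index.code (τ : Index a) : Σ _ : Finset ι, Finset ι := ⟨τ.B \ τ.S, τ.I ∪ τ.T⟩

theorem Index.I_disjoint (τ : Index a) {X : Finset ι} (hX : X ⊆ IA a τ.B) : Disjoint τ.I X :=
  Finset.disjoint_left.2 fun _ hi hi' => (mem_IP.1 (τ.I_subset hi)).2 (hX hi')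

theorem Index.code_mem (τ : Index a) :
    τ.code ∈ (indepBetween a ∅ Finset.univ).sigma fun C => C.powerset := by
  rw [Finset.mem_sigma, mem_indepBetween, Finset.mem_powerset]
  refine ⟨⟨by simp, by simp, τ.isBasis.1.mono (by simp [Index.code])⟩, ?_⟩
  refine Finset.union_subset (fun i hi => ?_) fun t ht => ?_
  · exact Finset.mem_sdiff.2 ⟨(mem_IP.1 (τ.I_subset hi)).1,
      Finset.disjoint_left.1 (τ.I_disjoint τ.S_subset) hi⟩
  · exact Finset.mem_sdiff.2 ⟨((mem_IA τ.isBasis).1 (τ.T_subset ht)).1,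
      Finset.disjoint_right.1 τ.disjoint ht⟩

/-- The criterion `mem_iff_of_subset_IA` recovers `S` from `B \ S` alone, hence `B`; then `I` and
`T` are the internally passive and active parts of their union. -/
theorem Index.code_injective : Function.Injective (Index.code : Index a → _) := by
  intro τ τ' h
  have hτ := τ.I_disjoint subset_rfl
  have hτ' := τ'.I_disjoint subset_rfl
  obtain ⟨B, I, S, T, hB, hI, hS, hT, hST⟩ := τ
  obtain ⟨B', I', S', T', hB', hI', hS', hT', hST'⟩ := τ'
  simp only [Index.code, Sigma.mk.injEq, heq_eq_eq] at h
  obtain ⟨h1, h2⟩ := h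
  have hSS : S = S' := by
    ext i
    rw [mem_iff_of_subset_IA hB hS, mem_iff_of_subset_IA hB' hS', h1]
  subst hSS
  have hBB : B = B' := by
    rw [← Finset.sdiff_union_of_subset fun i hi => ((mem_IA hB).1 (hS hi)).1, h1,
      Finset.sdiff_union_of_subset fun i hi => ((mem_IA hB').1 (hS' hi)).1]
  subst hBB
  have hmem (i : ι) : (i ∈ I ∨ i ∈ T) ↔ (i ∈ I' ∨ i ∈ T') := by
    rw [← Finset.mem_union, h2, Finset.mem_union]
  have hIA (i : ι) : i ∈ I → i ∉ IA a B := fun hi => Finset.disjoint_left.1 hτ hi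
  have hIA' (i : ι) : i ∈ I' → i ∉ IA a B := fun hi => Finset.disjoint_left.1 hτ' hi
  have hII : I = I' := by
    ext i
    have := hmem i
    have := hIA i
    have := hIA' i
    have := @hT i
    have := @hT' i
    tauto
  have hTT : T = T' := by
    ext i
    have := hmem i
    have := hIA i
    have := hIA' i
    have := @hT i
    have := @hT' i
    tauto
  subst hII hTT
  rfl

theorem Index.exists_code_eq {p : Σ _ : Finset ι, Finset ι}
    (hp : p ∈ (indepBetween a ∅ Finset.univ).sigma fun C => C.powerset) :
    ∃ τ : Index a, τ.code = p := by
  obtain ⟨C, T⟩ := p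
  rw [Finset.mem_sigma, mem_indepBetween, Finset.mem_powerset] at hp
  obtain ⟨B, S, hB, hS, rfl⟩ := exists_isBasis_sdiff hp.1.2.2
  have hT : T ⊆ B \ S := hp.2
  refine ⟨⟨B, T \ IA a B, S, T ∩ IA a B, hB, fun i hi => ?_, hS, Finset.inter_subset_right, ?_⟩, ?_⟩
  · rw [Finset.mem_sdiff] at hi
    exact mem_IP.2 ⟨(Finset.mem_sdiff.1 (hT hi.1)).1, hi.2⟩
  · exact Finset.disjoint_right.2 fun i hi =>
      (Finset.mem_sdiff.1 (hT (Finset.mem_inter.1 hi).1)).2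
  · simp [Index.code, Finset.sdiff_union_inter]

/-- Up to sign, an element of the family is the one attached to its code. -/
theorem Index.element_eq (τ : Index a) :
    ∃ c : ℂˣ, element a τ = c • passiveElement a Finset.univ τ.code.1 τ.code.2 := by
  have hdisj : Disjoint (EP a τ.B) τ.S := Finset.disjoint_left.2 fun i hi hi' =>
    ((mem_EP τ.isBasis).1 hi).1 ((mem_IA τ.isBasis).1 (τ.S_subset hi')).1
  have hperm : (τ.I.sort (· ≤ ·) ++ τ.T.sort (· ≤ ·)).Perm ((τ.I ∪ τ.T).sort (· ≤ ·)) := by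
    rw [List.perm_ext_iff_of_nodup _ (Finset.sort_nodup _ _)]
    · simp
    · refine (Finset.sort_nodup _ _).append (Finset.sort_nodup _ _) fun i hi hi' => ?_
      rw [Finset.mem_sort] at hi hi'
      exact Finset.disjoint_left.1 (τ.I_disjoint τ.T_subset) hi hi'
  obtain ⟨c, hc, hw⟩ := wedge_perm a hperm
  refine ⟨Units.mk0 c hc, ?_⟩
  rw [passiveElement, Index.code, passiveSet_sdiff τ.isBasis τ.S_subset,
    Finset.prod_union hdisj, map_mul, element, prodForm, prodForm, prodDForm_eq, prodDForm_eq,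
    mul_assoc (bos _), (commute_bos _ _).symm.eq, ← mul_assoc, mul_assoc _ (1 ⊗ₜ _ : Omega n),
    Algebra.TensorProduct.tmul_mul_tmul, ← wedge_append, hw, mul_one, TensorProduct.tmul_smul,
    mul_smul_comm, Units.smul_mk0]

end Bases

end Superspace

end

/-! ### Transfer from passive elements to the family of products. -/

theorem theorem5p3 {n : ℕ} {ι : Type*} [Fintype ι] [LinearOrder ι] (a : ι → Fin n → ℂ) :
    LinearIndependent ℂ (fun τ : Superspace.Index a => Superspace.element a τ) ∧
      Submodule.span ℂ (Set.range (fun τ : Superspace.Index a => Superspace.element a τ)) =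
        Superspace.inverseSystem (Superspace.superpowerIdeal a) := by
  choose c hc using fun τ : Superspace.Index a => τ.element_eq
  constructor
  -- The products are nonzero multiples of passive elements with distinct codes; linear independence
  -- also makes them pairwise distinct.
  · have h := (Superspace.linearIndepOn_passiveElement a).comp
      (fun τ : Superspace.Index a => ⟨τ.code, Finset.mem_coe.2 τ.code_mem⟩)
      fun τ τ' h => Superspace.Index.code_injective (congrArg Subtype.val h)
    rw [funext hc]
    exact h.units_smul c
  · rw [← Superspace.passiveSpan_eq_inverseSystem]
    refine le_antisymm (Submodule.span_le.2 ?_) (Submodule.span_le.2 ?_)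
    · rintro _ ⟨τ, rfl⟩
      have hτ := Finset.mem_sigma.1 τ.code_mem
      simp only [hc]
      exact Submodule.smul_mem _ _ (Submodule.subset_span
        ⟨_, hτ.1, _, Finset.mem_powerset.1 hτ.2, rfl⟩)
    · rintro _ ⟨C, hC, T, hT, rfl⟩
      obtain ⟨τ, hτ⟩ := Superspace.Index.exists_code_eq
        (Finset.mem_sigma.2 ⟨hC, Finset.mem_powerset.2 hT⟩ : (⟨C, T⟩ : Σ _ : Finset ι, Finset ι) ∈ _)
      have h := hc τ
      rw [hτ, eq_comm, ← eq_inv_smul_iff] at h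
      rw [SetLike.mem_coe, h]
      exact Submodule.smul_mem _ _ (Submodule.subset_span ⟨τ, rfl⟩)
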